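/- Let $\tau>0$, $C_n=C([-\tau,0],\mathbb C^n)$ with the uniform norm, and let $\mathcal L_0:C_n\to\mathbb C^n$ be bounded linear, $\mathcal L_0\varphi=\int_{-\tau}^0 d\eta(\theta)\varphi(\theta)$ with $\eta$ an $n\times n$ matrix-valued function of bounded variation. Let $A_0$ be the infinitesimal generator of the semiflow of $\dot z(t)=\mathcal L_0 z_t$, let $\Lambda$ be a non-empty finite set of eigenvalues of $A_0$, and let $\Phi=(\varphi_1,\dots,\varphi_c)$ be a basis of the corresponding generalized eigenspace $P$. On $C_n^*=C([0,\tau],\mathbb C^{n*})$ (row vectors) let $A_0^*\psi=-\dot\psi$, with domain the $C^1$ functions $\psi$ such that $-\dot\psi(0)=\int_{-\tau}^0\psi(-\theta)\,d\eta(\theta)$, and let $\Psi=\mathrm{col}(\psi_1,\dots,\psi_c)$ be a basis of the generalized eigenspace of $A_0^*$ for $\Lambda$ with $(\Psi,\Phi)_n=I_c$, where $$(\psi,\varphi)_n=\psi(0)\varphi(0)-\int_{-\tau}^0\int_0^\theta\psi(\xi-\theta)\,d\eta(\theta)\,\varphi(\xi)\,d\xi .$$ Let $B$ be the $c\times c$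 matrix with $\dot\Phi=\Phi B$. Put $Q^1=\{\varphi\in C^1([-\tau,0],\mathbb C^n):(\Psi,\varphi)_n=0\}$ with the $C^1$ norm. Let $X_0$ be the function on $[-\tau,0]$ equal to $I_n$ at $0$ and to $0$ elsewhere, let $BC_n=\{\varphi+X_0\mu:\varphi\in C_n,\ \mu\in\mathbb C^n\}\cong C_n\times\mathbb C^n$, let $\pi(\varphi+X_0\mu)=\Phi[(\Psi,\varphi)_n+\Psi(0)\mu]$, and let $A_{Q^1}\varphi=\dot\varphi+X_0[\mathcal L_0\varphi-\dot\varphi(0)]$ for $\varphi\in Q^1$. Let $\alpha\mapsto\mathcal L(\alpha)$ be a $C^\infty$ family (in the real sense), $\alpha\in\mathbb C^p$, of bounded linear operators $C_n\to\mathbb C^n$ with $\mathcal L(0)=\mathcal L_0$. For $\alpha\in\mathbb C^p$ and a row $h\in(Q^1)^c$ set $$N(\alpha,h)=(A_{Q^1}+(I-\pi)X_0[\mathcal L(\alpha)-\mathcal L_0])h+(I-\pi)X_0[\mathcal L(\alpha)-\mathcal L_0]\Phi-h\,(B+\Psi(0)[\mathcal L(\alpha)-\mathcal L_0](\Phi+h)),$$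 where $A_{Q^1}$, $\mathcal L(\alpha)$ and $\pi$ act componentwise. Then: 1. $N$ takes values in $(\ker\pi)^c$. 2. There are a connected open neighbourhood $V$ of $0$ in $\mathbb C^p$ and a $C^\infty$ map $h:V\to(Q^1)^c$ with $h(0)=0$ and $N(\alpha,h(\alpha))=0$ for all $\alpha\in V$, and $h$ is the unique such map on $V$, and on every smaller connected open neighbourhood of $0$. If $\mathcal L$ is $C^\infty$ in the complex sense, then so is $h$. 3. Let $V$ be any open neighbourhood of $0$ and $h:V\to(Q^1)^c$ any $C^\infty$ map with $h(0)=0$ and $N(\alpha,h(\alpha))=0$ on $V$. Let $R^1=\{w\in C^1([-\tau,0],\mathbb C^p):w(0)=0\}$ with the $C^1$ norm, and let $Y_0$ be the function on $[-\tau,0]$ equal to $I_p$ at $0$ and to $0$ elsewhere. Then the set $$W=\{((x,\alpha),(y,w))\in\mathbb C^{c+p}\times(Q^1\times R^1): w=0,\ y=h(\alpha)x,\ x\in\mathbb C^c,\ \alpha\in V\}$$ is a $C^\infty$ embedded submanifold of $\mathbb C^{c+p}\times(Q^1\times R^1)$ of real dimension $2(c+p)$ (a complex submanifold of dimension $c+p$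 if $h$ is $C^\infty$ in the complex sense). It is invariant under the forward semiflow of the system $$\begin{aligned}\dot x&=Bx+\Psi(0)[\mathcal L(\alpha+w(0))-\mathcal L_0](\Phi x+y),\qquad \dot\alpha=0,\\ \tfrac{d}{dt}y&=A_{Q^1}y+(I-\pi)X_0[\mathcal L(\alpha+w(0))-\mathcal L_0](\Phi x+y),\qquad \tfrac{d}{dt}w=\dot w-Y_0\dot w(0),\end{aligned}$$ where $\frac{d}{dt}y$ and $\frac{d}{dt}w$ are taken in $BC_n$ and $BC_p$: through each point of $W$ there is a solution on some interval $[0,T)$, and every solution on an interval $[0,T)$ that starts in $W$ stays in $W$. The dynamics on $W$ are $\dot x=\mathcal B(\alpha)x$ with $$\mathcal B(\alpha)=B+\Psi(0)[\mathcal L(\alpha)-\mathcal L_0](\Phi+h(\alpha)),$$ that is, for $\alpha\in V$ the curve $t\mapsto((x(t),\alpha),(h(\alpha)x(t),0))$ is a solution on $[0,T)$ if and only if $\dot x=\mathcal B(\alpha)x$ on $[0,T)$. -/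

import Mathlib

open Set Filter Topology MeasureTheory
open scoped ContDiff Matrix

/-! Conventions. The delay is `τ > 0`. Vectors of `ℂⁿ` and matrices of functions carry sup norms,
and products carry the maximum of the norms; these are equivalent to the corresponding sum norms,
so topology, smoothness and derivatives are the same for both. -/

/-- `C_n = C([-τ,0], ℂⁿ)` with the uniform norm. -/
abbrev PhaseSpace (τ : ℝ) (n : ℕ) : Type := C(Icc (-τ) (0 : ℝ), Fin n → ℂ)

/-- `C_n^* = C([0,τ], ℂ^{n*})`, functions with values in row vectors. -/
abbrev DualPhaseSpace (τ : ℝ) (n : ℕ) : Type := C(Icc (0 : ℝ) τ, Fin n → ℂ)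

/-- `BC_n`: the element `φ + X₀ μ` is the pair `(φ, μ)`. -/
abbrev JumpSpace (τ : ℝ) (n : ℕ) : Type := PhaseSpace τ n × (Fin n → ℂ)

section Basic

variable {τ : ℝ} [hτ : Fact (0 < τ)] {n : ℕ}

/-- `φ ∈ C_n` as a function on `ℝ` (extended by constants outside `[-τ,0]`). -/
noncomputable def extC (φ : PhaseSpace τ n) : ℝ → Fin n → ℂ :=
  IccExtend (neg_nonpos.mpr hτ.out.le) φ

/-- `ψ ∈ C_n^*` as a function on `ℝ` (extended by constants outside `[0,τ]`). -/
noncomputable def extD (ψ : DualPhaseSpace τ n) : ℝ → Fin n → ℂ :=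
  IccExtend hτ.out.le ψ

theorem continuous_extC (φ : PhaseSpace τ n) : Continuous (extC φ) :=
  φ.continuous.Icc_extend'

theorem continuous_extD (ψ : DualPhaseSpace τ n) : Continuous (extD ψ) :=
  ψ.continuous.Icc_extend'

@[simp] theorem extC_add (φ χ : PhaseSpace τ n) (θ : ℝ) :
    extC (φ + χ) θ = extC φ θ + extC χ θ := rfl

@[simp] theorem extC_smul (a : ℂ) (φ : PhaseSpace τ n) (θ : ℝ) :
    extC (a • φ) θ = a • extC φ θ := rfl

@[simp] theorem extC_zero (θ : ℝ) : extC (0 : PhaseSpace τ n) θ = 0 := rfl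

end Basic

section Stieltjes

/-- A function of bounded variation on `[-τ,0]` with values in the `n × n` complex matrices. -/
structure BVMatrix (τ : ℝ) (n : ℕ) where
  toFun : Icc (-τ) (0 : ℝ) → Matrix (Fin n) (Fin n) ℂ
  bv : ∀ i j, BoundedVariationOn (fun θ => toFun θ i j) univ

variable {τ : ℝ} {n : ℕ}

instance compactIccSpace_Icc (a b : ℝ) : CompactIccSpace (Icc a b) :=
  ⟨fun {_ _} => isClosed_Icc.isCompact⟩

/-- The complex Stieltjes measure `dη_{ij}` on `[-τ,0]`. -/
noncomputable def BVMatrix.measure (η : BVMatrix τ n) (i j : Fin n) :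
    ComplexMeasure (Icc (-τ) (0 : ℝ)) :=
  (η.bv i j).vectorMeasure

theorem ComplexMeasure.isFiniteMeasure_variation {X : Type*} [MeasurableSpace X]
    (μ : ComplexMeasure X) : IsFiniteMeasure (VectorMeasure.variation μ) := by
  have key : VectorMeasure.variation μ ≤
      (ComplexMeasure.re μ).totalVariation + (ComplexMeasure.im μ).totalVariation := by
    refine VectorMeasure.variation_le_of_forall_enorm_le fun E _ => ?_
    have h1 : ‖μ E‖ₑ ≤ ‖(μ E).re‖ₑ + ‖(μ E).im‖ₑ := by
      have h := Complex.norm_le_abs_re_add_abs_im (μ E)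
      rw [← ofReal_norm, ← ofReal_norm, ← ofReal_norm,
        ← ENNReal.ofReal_add (norm_nonneg _) (norm_nonneg _)]
      exact ENNReal.ofReal_le_ofReal h
    refine h1.trans ?_
    rw [Measure.add_apply]
    exact add_le_add (SignedMeasure.enorm_le_totalVariation (ComplexMeasure.re μ) E)
      (SignedMeasure.enorm_le_totalVariation (ComplexMeasure.im μ) E)
  exact isFiniteMeasure_of_le _ key

theorem BVMatrix.integrable (η : BVMatrix τ n) (i j : Fin n) (f : C(Icc (-τ) (0 : ℝ), ℂ)) :
    (η.measure i j).Integrable (fun θ => f θ) := by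
  have := ComplexMeasure.isFiniteMeasure_variation (η.measure i j)
  exact Integrable.of_bound f.continuous.aestronglyMeasurable ‖f‖
    (Eventually.of_forall fun θ => f.norm_coe_le_norm θ)

/-- The Stieltjes integral `∫_{-τ}^0 f(θ) dη_{ij}(θ)` of a continuous function `f`. -/
noncomputable def BVMatrix.integral (η : BVMatrix τ n) (i j : Fin n) :
    C(Icc (-τ) (0 : ℝ), ℂ) →ₗ[ℂ] ℂ where
  toFun f := (η.measure i j).integral (fun θ => f θ) (ContinuousLinearMap.mul ℝ ℂ)
  map_add' f g :=
    VectorMeasure.integral_fun_add (η.integrable i j f) (η.integrable i j g)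
  map_smul' a f := by
    refine setToFun_smul _ (fun b s x => ?_) a (fun θ => f θ)
    simp [VectorMeasure.transpose]
    ring

end Stieltjes

section Adjoint

variable {τ : ℝ} {n : ℕ}

/-- The `j`-th coordinate of `φ ∈ C_n`. -/
noncomputable def coordC (j : Fin n) (φ : PhaseSpace τ n) : C(Icc (-τ) (0 : ℝ), ℂ) :=
  ⟨fun θ => φ θ j, by fun_prop⟩

/-- `L₀ φ = ∫_{-τ}^0 dη(θ) φ(θ)` for all `φ ∈ C_n`. -/
def Represents (η : BVMatrix τ n) (L₀ : PhaseSpace τ n →L[ℂ] (Fin n → ℂ)) : Prop :=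
  ∀ φ i, L₀ φ i = ∑ j, η.integral i j (coordC j φ)

variable [hτ : Fact (0 < τ)]

/-- The continuous function `θ ↦ ∫_0^θ ψ_i(ξ - θ) φ_j(ξ) dξ` on `[-τ,0]`, linear in `φ`. -/
noncomputable def innerKernel (ψ : DualPhaseSpace τ n) (i j : Fin n) :
    PhaseSpace τ n →ₗ[ℂ] C(Icc (-τ) (0 : ℝ), ℂ) where
  toFun φ :=
    { toFun := fun θ => ∫ ξ in (0 : ℝ)..θ, extD ψ (ξ - θ) i * extC φ ξ j
      continuous_toFun := by
        have h1 := continuous_extD ψ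
        have h2 := continuous_extC φ
        have : Continuous fun t : ℝ => ∫ ξ in (0 : ℝ)..t, extD ψ (ξ - t) i * extC φ ξ j :=
          intervalIntegral.continuous_parametric_intervalIntegral_of_continuous
            (f := fun t ξ => extD ψ (ξ - t) i * extC φ ξ j) (by fun_prop) continuous_id
        exact this.comp continuous_subtype_val }
  map_add' φ χ := by
    ext θ
    have h1 := continuous_extD ψ
    have h2 := continuous_extC φ
    have h3 := continuous_extC χ
    simp only [extC_add, Pi.add_apply, mul_add, ContinuousMap.coe_mk, ContinuousMap.add_apply]
    exact intervalIntegral.integral_add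
      (Continuous.intervalIntegrable (by fun_prop) _ _)
      (Continuous.intervalIntegrable (by fun_prop) _ _)
  map_smul' a φ := by
    ext θ
    simp only [extC_smul, Pi.smul_apply, smul_eq_mul, ContinuousMap.coe_mk,
      ContinuousMap.smul_apply, RingHom.id_apply, mul_left_comm _ a]
    exact intervalIntegral.integral_const_mul _ _

/-- The bilinear form
`(ψ,φ)_n = ψ(0)φ(0) - ∫_{-τ}^0 ∫_0^θ ψ(ξ-θ) dη(θ) φ(ξ) dξ`, linear in `φ`. -/
noncomputable def adjointForm (η : BVMatrix τ n) (ψ : DualPhaseSpace τ n) :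
    PhaseSpace τ n →ₗ[ℂ] ℂ where
  toFun φ := extD ψ 0 ⬝ᵥ extC φ 0 - ∑ i, ∑ j, η.integral i j (innerKernel ψ i j φ)
  map_add' φ χ := by
    have h : extC (φ + χ) 0 = extC φ 0 + extC χ 0 := rfl
    simp only [h, map_add, dotProduct_add, Finset.sum_add_distrib]
    ring
  map_smul' a φ := by
    have h : extC (a • φ) 0 = a • extC φ 0 := rfl
    simp only [h, map_smul, dotProduct_smul, smul_eq_mul, RingHom.id_apply, ← Finset.mul_sum]
    ring

/-- The formal adjoint `A₀^*` on `C_n^*`: `ψ` is `C¹`, `χ = -ψ'`, and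
`-ψ'(0) = ∫_{-τ}^0 ψ(-θ) dη(θ)`. -/
def AdjointGenerator (η : BVMatrix τ n) (ψ χ : DualPhaseSpace τ n) : Prop :=
  (∀ s ∈ Icc (0 : ℝ) τ, HasDerivWithinAt (extD ψ) (-(extD χ s)) (Icc 0 τ) s) ∧
  ∀ j, extD χ 0 j = ∑ i, η.integral i j
    ⟨fun θ => extD ψ (-(θ : ℝ)) i,
      (continuous_apply i).comp ((continuous_extD ψ).comp continuous_subtype_val.neg)⟩

end Adjoint

section Generator

variable {τ : ℝ} [hτ : Fact (0 < τ)] {n : ℕ}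

/-- The segment `z_t(θ) = z(t + θ)`, `-τ ≤ θ ≤ 0`. -/
noncomputable def histSegment (τ : ℝ) (z : C(ℝ, Fin n → ℂ)) (t : ℝ) : PhaseSpace τ n :=
  ⟨fun θ => z (t + θ), by fun_prop⟩

/-- `z` solves `ż(t) = L z_t` for `t ≥ 0` with `z_0 = φ` (values of `z` to the left of `-τ` play
no role). -/
def IsRFDESolution (L : PhaseSpace τ n →L[ℂ] (Fin n → ℂ)) (φ : PhaseSpace τ n)
    (z : C(ℝ, Fin n → ℂ)) : Prop :=
  histSegment τ z 0 = φ ∧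
  ∀ t ∈ Ici (0 : ℝ), HasDerivWithinAt z (L (histSegment τ z t)) (Ici 0) t

/-- The infinitesimal generator `A₀` of the semiflow `T(t)φ = z_t` of `ż(t) = L z_t`: the relation
holds iff `φ` is in the domain of `A₀` and `A₀ φ = χ`. -/
def Generator (L : PhaseSpace τ n →L[ℂ] (Fin n → ℂ)) (φ χ : PhaseSpace τ n) : Prop :=
  ∃ z : C(ℝ, Fin n → ℂ), IsRFDESolution L φ z ∧
    Tendsto (fun t : ℝ => t⁻¹ • (histSegment τ z t - φ)) (𝓝[>] 0) (𝓝 χ)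

/-- For an unbounded operator `A` given by its graph, `v ∈ ker (A - lam)^k`. -/
def InKerPow {E : Type*} [AddCommGroup E] [Module ℂ E] (A : E → E → Prop) (lam : ℂ) :
    ℕ → E → Prop
  | 0, v => v = 0
  | k + 1, v => ∃ w, A v w ∧ InKerPow A lam k (w - lam • v)

/-- The generalized eigenspace of `A` for a set `Lam` of complex numbers: the sum over `lam ∈ Lam`
of `⋃_k ker (A - lam)^k`. -/
def generalizedEigenspace {E : Type*} [AddCommGroup E] [Module ℂ E] (A : E → E → Prop)
    (Lam : Finset ℂ) : Submodule ℂ E :=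
  Submodule.span ℂ {v | ∃ lam ∈ Lam, ∃ k, InKerPow A lam k v}

/-- The data of the decomposition `C_n = P ⊕ Q` for the equation `ż(t) = L₀ z_t`: the operator `L₀`
with its kernel `η`, the finite set `Lam` of eigenvalues of `A₀`, a basis `Phi` of the generalized
eigenspace `P`, the dual basis `Psi` of the generalized eigenspace `P^*` of the formal adjoint,
and the matrix `B` with `Φ̇ = Φ B`. -/
structure Splitting (τ : ℝ) [Fact (0 < τ)] (n c : ℕ) where
  L₀ : PhaseSpace τ n →L[ℂ] (Fin n → ℂ)
  η : BVMatrix τ n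
  represents : Represents η L₀
  Lam : Finset ℂ
  nonempty : Lam.Nonempty
  eigenvalue : ∀ lam ∈ Lam, ∃ φ : PhaseSpace τ n, φ ≠ 0 ∧ Generator L₀ φ (lam • φ)
  Phi : Fin c → PhaseSpace τ n
  Phi_linearIndependent : LinearIndependent ℂ Phi
  Phi_span : Submodule.span ℂ (range Phi) = generalizedEigenspace (Generator L₀) Lam
  Psi : Fin c → DualPhaseSpace τ n
  Psi_linearIndependent : LinearIndependent ℂ Psi
  Psi_span : Submodule.span ℂ (range Psi) = generalizedEigenspace (AdjointGenerator η) Lam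
  dual : ∀ i j, adjointForm η (Psi i) (Phi j) = if i = j then 1 else 0
  B : Matrix (Fin c) (Fin c) ℂ
  deriv_Phi : ∀ j, ∀ θ ∈ Icc (-τ) (0 : ℝ),
    HasDerivWithinAt (extC (Phi j)) (∑ i, B i j • extC (Phi i) θ) (Icc (-τ) 0) θ

end Generator

section Reduction

variable {τ : ℝ} [hτ : Fact (0 < τ)] {n c p : ℕ}

/-- `C_n^1` with the `C¹` norm: the `C¹` function `φ` is the pair `(φ, φ̇)` in `C_n × C_n`. -/
def C1 (τ : ℝ) [Fact (0 < τ)] (n : ℕ) : Submodule ℂ (PhaseSpace τ n × PhaseSpace τ n) where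
  carrier := {f | ∀ θ ∈ Icc (-τ) (0 : ℝ),
    HasDerivWithinAt (extC f.1) (extC f.2 θ) (Icc (-τ) 0) θ}
  add_mem' hf hg θ hθ := (hf θ hθ).add (hg θ hθ)
  zero_mem' θ _ := hasDerivWithinAt_const θ _ (0 : Fin n → ℂ)
  smul_mem' a _ hf θ hθ := (hf θ hθ).const_smul a

/-- `R¹`: the functions `w ∈ C_p^1` with `w(0) = 0`. -/
def R1 (τ : ℝ) [Fact (0 < τ)] (p : ℕ) : Submodule ℂ (PhaseSpace τ p × PhaseSpace τ p) where
  carrier := {f | f ∈ C1 τ p ∧ extC f.1 0 = 0}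
  add_mem' hf hg := ⟨add_mem hf.1 hg.1, by simp [hf.2, hg.2]⟩
  zero_mem' := ⟨zero_mem _, rfl⟩
  smul_mem' a _ hf := ⟨Submodule.smul_mem _ a hf.1, by simp [hf.2]⟩

namespace Splitting

variable (S : Splitting τ n c)

/-- `Q¹ = Q ∩ C_n^1`, where `Q = {φ : (Ψ,φ)_n = 0}`, with the `C¹` norm. -/
def Q1 : Submodule ℂ (PhaseSpace τ n × PhaseSpace τ n) where
  carrier := {f | f ∈ C1 τ n ∧ ∀ i, adjointForm S.η (S.Psi i) f.1 = 0}
  add_mem' hf hg := ⟨add_mem hf.1 hg.1, fun i => by simp [hf.2 i, hg.2 i]⟩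
  zero_mem' := ⟨zero_mem _, fun i => by simp⟩
  smul_mem' a _ hf := ⟨Submodule.smul_mem _ a hf.1, fun i => by simp [hf.2 i]⟩

/-- The underlying function of an element of `Q¹`. -/
def fn (y : S.Q1) : PhaseSpace τ n := y.1.1

/-- The derivative of an element of `Q¹`. -/
def dot (y : S.Q1) : PhaseSpace τ n := y.1.2

/-- The `c × n` matrix `Ψ(0)`. -/
noncomputable def Psi0 : Matrix (Fin c) (Fin n) ℂ := Matrix.of fun i => extD (S.Psi i) 0

/-- `Φ x` for `x ∈ ℂ^c`. -/
noncomputable def PhiMul (x : Fin c → ℂ) : PhaseSpace τ n := ∑ j, x j • S.Phi j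

/-- The projection `π(φ + X₀ μ) = Φ [(Ψ,φ)_n + Ψ(0) μ]` of `BC_n` onto `P`. -/
noncomputable def proj (ξ : JumpSpace τ n) : PhaseSpace τ n :=
  S.PhiMul (fun i => adjointForm S.η (S.Psi i) ξ.1 + (S.Psi0 *ᵥ ξ.2) i)

/-- `(I - π) X₀ μ`. -/
noncomputable def jump (μ : Fin n → ℂ) : JumpSpace τ n := (0, μ) - (S.proj (0, μ), 0)

/-- `A_{Q¹} φ = φ̇ + X₀ [L₀ φ - φ̇(0)]`. -/
noncomputable def AQ (y : S.Q1) : JumpSpace τ n :=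
  (S.dot y, S.L₀ (S.fn y) - extC (S.dot y) 0)

variable (L : (Fin p → ℂ) → PhaseSpace τ n →L[ℂ] (Fin n → ℂ))

/-- The `c × c` matrix `B + Ψ(0) [L(α) - L₀] (Φ + h)`, for `h ∈ (Q¹)^c` viewed as a row. -/
noncomputable def reducedMatrix (α : Fin p → ℂ) (h : Fin c → S.Q1) :
    Matrix (Fin c) (Fin c) ℂ :=
  S.B + S.Psi0 * Matrix.of fun k j => (L α - S.L₀) (S.Phi j + S.fn (h j)) k

/-- The nonlinear operator `N(α,h) = (A_{Q¹} + (I-π) X₀ [L(α) - L₀]) h + (I-π) X₀ [L(α) - L₀] Φ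
- h (B + Ψ(0) [L(α) - L₀] (Φ + h))`, componentwise in the row `h ∈ (Q¹)^c`. -/
noncomputable def N (α : Fin p → ℂ) (h : Fin c → S.Q1) : Fin c → JumpSpace τ n := fun j =>
  S.AQ (h j) + S.jump ((L α - S.L₀) (S.fn (h j))) + S.jump ((L α - S.L₀) (S.Phi j))
    - (∑ i, S.reducedMatrix L α h i j • S.fn (h i), 0)

/-- `h x = ∑_j x_j h^j` for a row `h ∈ (Q¹)^c` and `x ∈ ℂ^c`. -/
noncomputable def rowMul (h : Fin c → S.Q1) (x : Fin c → ℂ) : S.Q1 := ∑ j, x j • h j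

/-- The space `ℂ^{c+p} × Q̃¹` of points `((x,α),(y,w))`, where `Q̃¹ = Q¹ × R¹`. -/
abbrev State (p : ℕ) : Type := ((Fin c → ℂ) × (Fin p → ℂ)) × (S.Q1 × R1 τ p)

/-- `γ = ((x,α),(y,w))` is a solution on `[0,T)` of the projected system
`ẋ = B x + Ψ(0) [L(α + w(0)) - L₀] (Φ x + y)`, `α̇ = 0`,
`dy/dt = A_{Q¹} y + (I-π) X₀ [L(α + w(0)) - L₀] (Φ x + y)`, `dw/dt = ẇ - Y₀ ẇ(0)`.
The time derivatives of `y` and `w` are taken in `BC_n` and `BC_p`. -/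
def IsSolution (T : ℝ) (γ : ℝ → S.State p) : Prop :=
  ∀ t ∈ Ico (0 : ℝ) T,
    let x := (γ t).1.1
    let α := (γ t).1.2
    let y := (γ t).2.1
    let w : PhaseSpace τ p := (γ t).2.2.1.1
    let w' : PhaseSpace τ p := (γ t).2.2.1.2
    let F : Fin n → ℂ := (L (α + extC w 0) - S.L₀) (S.PhiMul x + S.fn y)
    HasDerivWithinAt (fun s => (γ s).1.1) (S.B *ᵥ x + S.Psi0 *ᵥ F) (Ico 0 T) t ∧
    HasDerivWithinAt (fun s => (γ s).1.2) 0 (Ico 0 T) t ∧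
    HasDerivWithinAt (fun s => ((S.fn (γ s).2.1, 0) : JumpSpace τ n)) (S.AQ y + S.jump F)
      (Ico 0 T) t ∧
    HasDerivWithinAt (fun s => (((γ s).2.2.1.1, 0) : JumpSpace τ p)) (w', -extC w' 0)
      (Ico 0 T) t

/-- The set `W = {((x,α),(y,w)) : w = 0, y = h(α) x, x ∈ ℂ^c, α ∈ V}`. -/
def W (V : Set (Fin p → ℂ)) (h : (Fin p → ℂ) → Fin c → S.Q1) : Set (S.State p) :=
  {s | s.1.2 ∈ V ∧ s.2.1 = S.rowMul (h s.1.2) s.1.1 ∧ s.2.2 = 0}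

/-- Semiflow invariance of `M`: through every point of `M` there is a forward solution, and each
forward solution that starts in `M` stays in `M` as long as it exists. -/
def SemiflowInvariant (M : Set (S.State p)) : Prop :=
  ∀ s ∈ M, (∃ T > 0, ∃ γ, γ 0 = s ∧ S.IsSolution L T γ) ∧
    ∀ T > 0, ∀ γ, γ 0 = s → S.IsSolution L T γ → ∀ t ∈ Ico (0 : ℝ) T, γ t ∈ M

end Splitting

end Reduction

/-- `M` is an embedded `C^∞` submanifold of dimension `d` over `𝕜` of the normed space `E`: near
each of its points a diffeomorphism between open subsets of `E` takes `M` to a `d`-dimensional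
linear subspace. -/
def IsSmoothSubmanifold (𝕜 : Type*) [NontriviallyNormedField 𝕜] {E : Type*}
    [NormedAddCommGroup E] [NormedSpace 𝕜 E] (d : ℕ) (M : Set E) : Prop :=
  ∀ q ∈ M, ∃ e : OpenPartialHomeomorph E E, q ∈ e.source ∧
    ContDiffOn 𝕜 ∞ e e.source ∧ ContDiffOn 𝕜 ∞ e.symm e.target ∧
    ∃ F : Submodule 𝕜 E, FiniteDimensional 𝕜 F ∧ Module.finrank 𝕜 F = d ∧
      ∀ s ∈ e.source, s ∈ M ↔ e s ∈ F

/-! The core is that the linear operator h ↦ A h − h B is a bijection from (Q¹)^c onto (ker π)^c.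
Put ℓ = L(α) − L₀. Then N is polynomial in (ℓ, h), takes values in ker π, and reduces to this
operator at ℓ = 0. The implicit function theorem with the operator ℓ itself as parameter gives a
complex smooth H, and h(α) = H(L(α) − L₀) inherits real or complex smoothness from L.

Values in ker π: integration by parts shows that the formal adjoint is adjoint to φ ↦ φ̇ + X₀[L₀φ −
φ̇(0)] for the bilinear form (`AdjointGenerator.adjointForm_eq`), and the span of Ψ is invariant
under the formal adjoint. So A maps the annihilator Q¹ of Ψ into ker π.

Injectivity (`row_eq_zero`): if A h = h B, then x ↦ h x intertwines B with A₀. The generalized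
eigenvectors of B for Λ span ℂ^c, so every h x lies in P. It also lies in Q, and P ∩ Q = 0.

Surjectivity (`rowOp_surjective`): the initial value problem φ̇ − φB = χ, φ(0) = μ is always
solvable, and A h − h B, extended to all of C¹ by the identity on P, differs from it by finite rank.
A finite-rank perturbation of a surjection is surjective once it is injective.

Invariance: multiplying N(α, h) = 0 by x shows that y = h x solves the second equation when ẋ =
ℬ(α)x, so exponentials give solutions inside W. All other solutions starting in W coincide with
these (`IsSolution.eq`): u = Φx + y satisfies the transport equation ∂ₜu = ∂_θu with boundary
condition ∂_θu(t,0) = L(α)u(t), for which a weighted sup-norm estimate along characteristics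
(`eq_zero_of_transport`) gives uniqueness. The component w is treated in the same way, with boundary
condition ẇ(0) = 0. -/

/-! ### The bilinear form: continuity and the adjoint identity -/

section DualForm

variable {τ : ℝ} {n : ℕ}

/-- The function `f` placed in the `j`-th coordinate. -/
noncomputable def embedCoord (j : Fin n) : C(Icc (-τ) (0 : ℝ), ℂ) →L[ℂ] PhaseSpace τ n where
  toFun f := ⟨fun θ => Pi.single j (f θ), (continuous_single j).comp f.continuous⟩
  map_add' f g := by ext θ i; simp [Pi.single_add]
  map_smul' a f := by ext θ i; by_cases h : i = j <;> simp [h]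
  cont := by
    refine (ContinuousMap.continuous_postcomp
      (⟨fun z : ℂ => (Pi.single j z : Fin n → ℂ),
        continuous_single (A := fun _ : Fin n => ℂ) j⟩ : C(ℂ, Fin n → ℂ)))

theorem coordC_embedCoord (i j : Fin n) (f : C(Icc (-τ) (0 : ℝ), ℂ)) :
    coordC i (embedCoord j f) = if i = j then f else 0 := by
  ext θ
  by_cases h : i = j <;> simp [coordC, embedCoord, h]

/-- Testing L₀ on functions with a single nonzero coordinate recovers each Stieltjes integral.
Continuity of the integrals, and so of the bilinear form, then comes from boundedness of L₀ rather
than from an estimate by the variation of η. -/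
theorem Represents.integral_eq {η : BVMatrix τ n} {L₀ : PhaseSpace τ n →L[ℂ] (Fin n → ℂ)}
    (h : Represents η L₀) (i j : Fin n) (f : C(Icc (-τ) (0 : ℝ), ℂ)) :
    η.integral i j f = L₀ (embedCoord j f) i := by
  rw [h, Finset.sum_eq_single j (fun k _ hk => by rw [coordC_embedCoord, if_neg hk, map_zero])
    (fun hj => absurd (Finset.mem_univ j) hj), coordC_embedCoord, if_pos rfl]

theorem Represents.continuous_integral {η : BVMatrix τ n}
    {L₀ : PhaseSpace τ n →L[ℂ] (Fin n → ℂ)} (h : Represents η L₀) (i j : Fin n) :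
    Continuous (η.integral i j) := by
  have : (η.integral i j : C(Icc (-τ) (0 : ℝ), ℂ) → ℂ) = fun f => L₀ (embedCoord j f) i :=
    funext (h.integral_eq i j)
  rw [this]
  fun_prop

variable [hτ : Fact (0 < τ)]

theorem extC_coe (φ : PhaseSpace τ n) (θ : Icc (-τ) (0 : ℝ)) : extC φ θ = φ θ :=
  IccExtend_val _ _ θ

theorem norm_extC_le (φ : PhaseSpace τ n) (θ : ℝ) : ‖extC φ θ‖ ≤ ‖φ‖ :=
  φ.norm_coe_le_norm _

theorem norm_extD_le (ψ : DualPhaseSpace τ n) (s : ℝ) : ‖extD ψ s‖ ≤ ‖ψ‖ :=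
  ψ.norm_coe_le_norm _

theorem phaseSpace_ext {φ χ : PhaseSpace τ n}
    (h : ∀ θ ∈ Icc (-τ) (0 : ℝ), extC φ θ = extC χ θ) : φ = χ := by
  ext1 θ
  rw [← extC_coe, ← extC_coe]
  exact h θ θ.2

theorem continuous_innerKernel (ψ : DualPhaseSpace τ n) (i j : Fin n) :
    Continuous (innerKernel ψ i j) := by
  refine AddMonoidHomClass.continuous_of_bound (innerKernel ψ i j) (‖ψ‖ * τ) fun φ => ?_
  refine (ContinuousMap.norm_le _ (by have := hτ.out; positivity)).2 fun θ => ?_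
  have h := intervalIntegral.norm_integral_le_of_norm_le_const (a := (0 : ℝ)) (b := θ)
    (f := fun ξ => extD ψ (ξ - θ) i * extC φ ξ j) (C := ‖ψ‖ * ‖φ‖) (fun ξ _ => by
      rw [norm_mul]
      exact mul_le_mul ((norm_le_pi_norm _ i).trans (norm_extD_le ψ _))
        ((norm_le_pi_norm _ j).trans (norm_extC_le φ _)) (norm_nonneg _) (norm_nonneg _))
  have h2 : |(θ : ℝ) - 0| ≤ τ := by
    rw [sub_zero, abs_le]; exact ⟨θ.2.1, θ.2.2.trans hτ.out.le⟩
  calc _ ≤ ‖ψ‖ * ‖φ‖ * |(θ : ℝ) - 0| := h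
    _ ≤ ‖ψ‖ * ‖φ‖ * τ := by gcongr
    _ = _ := by ring

/-- Evaluation of (the extension of) `φ ∈ C_n` at a point. -/
noncomputable def evalC (θ : ℝ) : PhaseSpace τ n →L[ℂ] (Fin n → ℂ) where
  toFun φ := extC φ θ
  map_add' _ _ := rfl
  map_smul' _ _ := rfl
  cont := ContinuousEvalConst.continuous_eval_const (F := PhaseSpace τ n) _

theorem evalC_apply (θ : ℝ) (φ : PhaseSpace τ n) : evalC θ φ = extC φ θ := rfl

theorem Represents.continuous_adjointForm {η : BVMatrix τ n}
    {L₀ : PhaseSpace τ n →L[ℂ] (Fin n → ℂ)} (h : Represents η L₀) (ψ : DualPhaseSpace τ n) :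
    Continuous (adjointForm η ψ) := by
  have h1 : Continuous fun φ : PhaseSpace τ n => extD ψ 0 ⬝ᵥ extC φ 0 := by
    have : Continuous fun φ : PhaseSpace τ n => extC φ 0 := (evalC (n := n) (τ := τ) 0).continuous
    exact continuous_const.dotProduct this
  refine h1.sub ?_
  exact continuous_finsetSum _ fun i _ => continuous_finsetSum _ fun j _ =>
    (h.continuous_integral i j).comp (continuous_innerKernel ψ i j)

theorem innerKernel_add_left (ψ χ : DualPhaseSpace τ n) (i j : Fin n) (φ : PhaseSpace τ n) :
    innerKernel (ψ + χ) i j φ = innerKernel ψ i j φ + innerKernel χ i j φ := by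
  ext θ
  have h1 := continuous_extD ψ
  have h2 := continuous_extD χ
  have h3 := continuous_extC φ
  have h : ∀ s, extD (ψ + χ) s = extD ψ s + extD χ s := fun _ => rfl
  simp only [innerKernel, LinearMap.coe_mk, AddHom.coe_mk, ContinuousMap.coe_mk,
    ContinuousMap.add_apply, h, Pi.add_apply, add_mul]
  exact intervalIntegral.integral_add
    (Continuous.intervalIntegrable (by fun_prop) _ _)
    (Continuous.intervalIntegrable (by fun_prop) _ _)

theorem innerKernel_smul_left (a : ℂ) (ψ : DualPhaseSpace τ n) (i j : Fin n)
    (φ : PhaseSpace τ n) : innerKernel (a • ψ) i j φ = a • innerKernel ψ i j φ := by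
  ext θ
  have h : ∀ s, extD (a • ψ) s = a • extD ψ s := fun _ => rfl
  simp only [innerKernel, LinearMap.coe_mk, AddHom.coe_mk, ContinuousMap.coe_mk,
    ContinuousMap.smul_apply, h, Pi.smul_apply, smul_eq_mul, mul_assoc]
  exact intervalIntegral.integral_const_mul _ _

theorem adjointForm_add_left (η : BVMatrix τ n) (ψ χ : DualPhaseSpace τ n)
    (φ : PhaseSpace τ n) :
    adjointForm η (ψ + χ) φ = adjointForm η ψ φ + adjointForm η χ φ := by
  have h : extD (ψ + χ) 0 = extD ψ 0 + extD χ 0 := rfl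
  simp only [adjointForm, LinearMap.coe_mk, AddHom.coe_mk, innerKernel_add_left, h, map_add,
    add_dotProduct, Finset.sum_add_distrib]
  ring

theorem adjointForm_smul_left (η : BVMatrix τ n) (a : ℂ) (ψ : DualPhaseSpace τ n)
    (φ : PhaseSpace τ n) : adjointForm η (a • ψ) φ = a * adjointForm η ψ φ := by
  have h : extD (a • ψ) 0 = a • extD ψ 0 := rfl
  simp only [adjointForm, LinearMap.coe_mk, AddHom.coe_mk, innerKernel_smul_left, h, map_smul,
    smul_dotProduct, smul_eq_mul, ← Finset.mul_sum]
  ring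

/-- Linear combinations of vectors annihilating `φ` annihilate `φ`. -/
theorem adjointForm_eq_zero_of_mem_span {ι : Type*} (η : BVMatrix τ n)
    (Ψ : ι → DualPhaseSpace τ n) (φ : PhaseSpace τ n) (h : ∀ i, adjointForm η (Ψ i) φ = 0)
    {χ : DualPhaseSpace τ n} (hχ : χ ∈ Submodule.span ℂ (range Ψ)) : adjointForm η χ φ = 0 := by
  induction hχ using Submodule.span_induction with
  | mem x hx => obtain ⟨i, rfl⟩ := hx; exact h i
  | zero => 
    have h0 := adjointForm_smul_left η 0 (0 : DualPhaseSpace τ n) φ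
    have e : (0 : ℂ) • (0 : DualPhaseSpace τ n) = 0 := by ext; simp
    rwa [zero_mul, e] at h0
  | add x y _ _ hx hy => rw [adjointForm_add_left, hx, hy, add_zero]
  | smul a x _ hx => rw [adjointForm_smul_left, hx, mul_zero]

/-- The function `θ ↦ ψ_i(-θ)` on `[-τ,0]`. -/
noncomputable def reflectCoord (ψ : DualPhaseSpace τ n) (i : Fin n) : C(Icc (-τ) (0 : ℝ), ℂ) :=
  ⟨fun θ => extD ψ (-(θ : ℝ)) i,
    (continuous_apply i).comp ((continuous_extD ψ).comp continuous_subtype_val.neg)⟩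

/-- Integration by parts in the inner integral of the bilinear form. -/
theorem innerKernel_deriv {ψ χ : DualPhaseSpace τ n}
    (hψ : ∀ s ∈ Icc (0 : ℝ) τ, HasDerivWithinAt (extD ψ) (-(extD χ s)) (Icc 0 τ) s)
    {f : PhaseSpace τ n × PhaseSpace τ n} (hf : f ∈ C1 τ n) (i j : Fin n) :
    innerKernel ψ i j f.2 = extD ψ 0 i • coordC j f.1 - extC f.1 0 j • reflectCoord ψ i
      + innerKernel χ i j f.1 := by
  ext θ
  have h1 := continuous_extD ψ
  have h2 := continuous_extD χ
  have h3 := continuous_extC f.1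
  have h4 := continuous_extC f.2
  have hθ := θ.2.2
  have hθ' := θ.2.1
  have key := intervalIntegral.integral_mul_deriv_eq_deriv_mul_of_hasDerivAt
    (a := (0 : ℝ)) (b := θ) (u := fun ξ => extD ψ (ξ - θ) i) (v := fun ξ => extC f.1 ξ j)
    (u' := fun ξ => -(extD χ (ξ - θ) i)) (v' := fun ξ => extC f.2 ξ j)
    (Continuous.continuousOn (by fun_prop)) (Continuous.continuousOn (by fun_prop))
    (fun ξ hξ => by
      rw [min_eq_right hθ, max_eq_left hθ] at hξ
      have hs : ξ - θ ∈ Ioo (0 : ℝ) τ := ⟨by linarith [hξ.1], by linarith [hξ.2]⟩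
      have := (hψ _ (Ioo_subset_Icc_self hs)).hasDerivAt (Icc_mem_nhds hs.1 hs.2)
      exact (hasDerivAt_pi.1 (this.comp_sub_const ξ (θ : ℝ)) i))
    (fun ξ hξ => by
      rw [min_eq_right hθ, max_eq_left hθ] at hξ
      have hs : ξ ∈ Ioo (-τ) (0 : ℝ) := ⟨by linarith [hξ.1], hξ.2⟩
      exact hasDerivAt_pi.1
        ((hf _ (Ioo_subset_Icc_self hs)).hasDerivAt (Icc_mem_nhds hs.1 hs.2)) j)
    (Continuous.intervalIntegrable (by fun_prop) _ _)
    (Continuous.intervalIntegrable (by fun_prop) _ _)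
  simp only [neg_mul, intervalIntegral.integral_neg, sub_neg_eq_add, sub_self, zero_sub] at key
  simp only [innerKernel, LinearMap.coe_mk, AddHom.coe_mk, ContinuousMap.coe_mk,
    ContinuousMap.add_apply, ContinuousMap.sub_apply, ContinuousMap.smul_apply, reflectCoord,
    coordC, smul_eq_mul]
  rw [key, extC_coe, mul_comm (extC f.1 0 j)]
  rfl

/-- The formal adjoint is the adjoint of `φ ↦ φ̇ + X₀ [L₀ φ - φ̇(0)]`. -/
theorem AdjointGenerator.adjointForm_eq {η : BVMatrix τ n}
    {L₀ : PhaseSpace τ n →L[ℂ] (Fin n → ℂ)} (h : Represents η L₀) {ψ χ : DualPhaseSpace τ n}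
    (hψ : AdjointGenerator η ψ χ) {f : PhaseSpace τ n × PhaseSpace τ n} (hf : f ∈ C1 τ n) :
    adjointForm η ψ f.2 + extD ψ 0 ⬝ᵥ (L₀ f.1 - extC f.2 0) = adjointForm η χ f.1 := by
  -- Boundary term at ξ = θ of the integration by parts: ψ(0)φ(θ), which integrates to ψ(0)L₀φ.
  have e1 : ∑ i, ∑ j, η.integral i j (extD ψ 0 i • coordC j f.1) = extD ψ 0 ⬝ᵥ L₀ f.1 := by
    simp only [map_smul, smul_eq_mul, ← Finset.mul_sum, dotProduct, h f.1]
  -- Boundary term at ξ = 0: ψ(−θ)φ(0). The boundary condition in the domain of the formal adjoint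
  -- turns its integral into χ(0)φ(0), the point term of (χ, φ).
  have e2 : ∑ i, ∑ j, η.integral i j (extC f.1 0 j • reflectCoord ψ i)
      = extD χ 0 ⬝ᵥ extC f.1 0 := by
    rw [Finset.sum_comm]
    simp only [map_smul, smul_eq_mul, dotProduct, hψ.2, mul_comm (extC f.1 0 _), Finset.sum_mul]
    rfl
  simp only [adjointForm, LinearMap.coe_mk, AddHom.coe_mk, innerKernel_deriv hψ.1 hf, map_add,
    map_sub, Finset.sum_add_distrib, Finset.sum_sub_distrib, e1, e2, dotProduct_sub]
  ring

theorem AdjointGenerator.add {η : BVMatrix τ n} {ψ χ ψ' χ' : DualPhaseSpace τ n}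
    (h : AdjointGenerator η ψ χ) (h' : AdjointGenerator η ψ' χ') :
    AdjointGenerator η (ψ + ψ') (χ + χ') := by
  refine ⟨fun s hs => ?_, fun j => ?_⟩
  · refine ((h.1 s hs).add (h'.1 s hs)).congr_deriv ?_
    have : extD (χ + χ') s = extD χ s + extD χ' s := rfl
    rw [this, neg_add]
  · change extD χ 0 j + extD χ' 0 j = _
    rw [h.2, h'.2, ← Finset.sum_add_distrib]
    refine Finset.sum_congr rfl fun i _ => ?_
    rw [← map_add]
    rfl

theorem AdjointGenerator.smul {η : BVMatrix τ n} {ψ χ : DualPhaseSpace τ n} (a : ℂ)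
    (h : AdjointGenerator η ψ χ) : AdjointGenerator η (a • ψ) (a • χ) := by
  refine ⟨fun s hs => ?_, fun j => ?_⟩
  · refine ((h.1 s hs).const_smul a).congr_deriv ?_
    have : extD (a • χ) s = a • extD χ s := rfl
    rw [this, smul_neg]
  · change a • extD χ 0 j = _
    rw [h.2, Finset.smul_sum]
    refine Finset.sum_congr rfl fun i _ => ?_
    rw [← map_smul]
    rfl

theorem AdjointGenerator.zero (η : BVMatrix τ n) : AdjointGenerator η 0 0 := by
  refine ⟨fun s _ => ?_, fun j => ?_⟩
  · exact (hasDerivWithinAt_const s _ (0 : Fin n → ℂ)).congr_deriv neg_zero.symm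
  · symm
    exact Finset.sum_eq_zero fun i _ => map_zero (η.integral i j)

/-- The domain of the formal adjoint contains its generalized eigenspaces, and the latter are
invariant. -/
theorem exists_adjointGenerator {η : BVMatrix τ n} {Lam : Finset ℂ} {ψ : DualPhaseSpace τ n}
    (hψ : ψ ∈ generalizedEigenspace (AdjointGenerator η) Lam) :
    ∃ χ ∈ generalizedEigenspace (AdjointGenerator η) Lam, AdjointGenerator η ψ χ := by
  unfold generalizedEigenspace at hψ
  induction hψ using Submodule.span_induction with
  | mem v hv =>
    obtain ⟨lam, hlam, k, hk⟩ := hv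
    cases k with
    | zero =>
      obtain rfl : v = 0 := hk
      exact ⟨0, zero_mem _, .zero η⟩
    | succ k =>
      have hv := hk
      obtain ⟨w, hw, hk⟩ := hk
      refine ⟨w, ?_, hw⟩
      have h1 : w - lam • v ∈ generalizedEigenspace (AdjointGenerator η) Lam :=
        Submodule.subset_span ⟨lam, hlam, k, hk⟩
      have h2 : v ∈ generalizedEigenspace (AdjointGenerator η) Lam :=
        Submodule.subset_span ⟨lam, hlam, k + 1, hv⟩
      simpa using add_mem h1 (Submodule.smul_mem _ lam h2)
  | zero => exact ⟨0, zero_mem _, .zero η⟩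
  | add x y _ _ hx hy =>
    obtain ⟨a, ha, ha'⟩ := hx
    obtain ⟨b, hb, hb'⟩ := hy
    exact ⟨a + b, add_mem ha hb, ha'.add hb'⟩
  | smul c x _ hx =>
    obtain ⟨a, ha, ha'⟩ := hx
    exact ⟨c • a, Submodule.smul_mem _ c ha, ha'.smul c⟩

end DualForm

/-! ### The projection π in coordinates, and N with values in ker π -/

namespace Splitting

variable {τ : ℝ} [hτ : Fact (0 < τ)] {n c p : ℕ} (S : Splitting τ n c)

/-- The coordinates `(Ψ,φ)_n + Ψ(0) μ` of the projection of `φ + X₀ μ` to `P`. -/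
noncomputable def coef : JumpSpace τ n →L[ℂ] (Fin c → ℂ) where
  toFun ξ i := adjointForm S.η (S.Psi i) ξ.1 + (S.Psi0 *ᵥ ξ.2) i
  map_add' ξ ζ := by
    ext i
    simp only [Prod.fst_add, Prod.snd_add, map_add, Matrix.mulVec_add, Pi.add_apply]
    ring
  map_smul' a ξ := by
    ext i
    simp only [Prod.smul_fst, Prod.smul_snd, map_smul, Matrix.mulVec_smul, Pi.smul_apply,
      RingHom.id_apply, smul_eq_mul]
    ring
  cont := by
    refine continuous_pi fun i => ?_
    have := S.represents.continuous_adjointForm (S.Psi i)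
    have h2 : Continuous fun ξ : JumpSpace τ n => S.Psi0 *ᵥ ξ.2 :=
      continuous_const.matrix_mulVec continuous_snd
    fun_prop

theorem coef_apply (ξ : JumpSpace τ n) (i : Fin c) :
    S.coef ξ i = adjointForm S.η (S.Psi i) ξ.1 + (S.Psi0 *ᵥ ξ.2) i := rfl

/-- `x ↦ Φ x` as a continuous linear map. -/
noncomputable def PhiL : (Fin c → ℂ) →L[ℂ] PhaseSpace τ n :=
  ∑ j, (ContinuousLinearMap.proj (R := ℂ) (φ := fun _ : Fin c => ℂ) j).smulRight (S.Phi j)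

theorem PhiL_apply (x : Fin c → ℂ) : S.PhiL x = S.PhiMul x := by
  simp [PhiL, PhiMul]

theorem proj_eq (ξ : JumpSpace τ n) : S.proj ξ = S.PhiL (S.coef ξ) := (S.PhiL_apply _).symm

/-- This is the normalization (Ψ,Φ) = I. It makes π a projection, Φ injective and P ∩ Q trivial. -/
theorem coef_PhiL (x : Fin c → ℂ) : S.coef (S.PhiL x, 0) = x := by
  ext i
  simp [coef_apply, PhiL_apply, PhiMul, map_sum, S.dual]

theorem coef_jump (μ : Fin n → ℂ) : S.coef (S.jump μ) = 0 := by
  rw [jump, map_sub, proj_eq, coef_PhiL, sub_self]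

theorem coef_fn (y : S.Q1) : S.coef (S.fn y, 0) = 0 := by
  ext i
  have := y.2.2 i
  simpa [coef_apply, fn] using this

/-- `A_{Q¹}` takes values in `ker π`. -/
theorem coef_deriv {f : PhaseSpace τ n × PhaseSpace τ n} (hf : f ∈ S.Q1) :
    S.coef (f.2, S.L₀ f.1 - extC f.2 0) = 0 := by
  ext i
  have hi : S.Psi i ∈ generalizedEigenspace (AdjointGenerator S.η) S.Lam :=
    S.Psi_span ▸ Submodule.subset_span (mem_range_self i)
  obtain ⟨χ, hχ, h⟩ := exists_adjointGenerator hi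
  rw [← S.Psi_span] at hχ
  exact (h.adjointForm_eq S.represents hf.1).trans
    (adjointForm_eq_zero_of_mem_span S.η S.Psi f.1 hf.2 hχ)

theorem coef_AQ (y : S.Q1) : S.coef (S.AQ y) = 0 := S.coef_deriv y.2

theorem coef_N (L : (Fin p → ℂ) → PhaseSpace τ n →L[ℂ] (Fin n → ℂ)) (α : Fin p → ℂ)
    (h : Fin c → S.Q1) (j : Fin c) : S.coef (S.N L α h j) = 0 := by
  have e : ((∑ i, S.reducedMatrix L α h i j • S.fn (h i), 0) : JumpSpace τ n)
      = ∑ i, S.reducedMatrix L α h i j • (S.fn (h i), 0) := by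
    ext1 <;> simp [Prod.fst_sum, Prod.snd_sum]
  rw [N, e]
  simp only [map_sub, map_add, map_sum, map_smul, coef_AQ, coef_jump, coef_fn]
  simp

theorem proj_N (L : (Fin p → ℂ) → PhaseSpace τ n →L[ℂ] (Fin n → ℂ)) (α : Fin p → ℂ)
    (h : Fin c → S.Q1) (j : Fin c) : S.proj (S.N L α h j) = 0 := by
  rw [proj_eq, coef_N, map_zero]

end Splitting

/-! ### Rows, characteristics and linear flows -/

section Row

variable {τ : ℝ} {n c : ℕ}

/-- `Φ x = ∑ⱼ xⱼ φⱼ` for a row `Φ = (φ₁,…,φ_c)`. -/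
noncomputable def rowC (φ : Fin c → PhaseSpace τ n) : (Fin c → ℂ) →L[ℂ] PhaseSpace τ n :=
  ∑ j, (ContinuousLinearMap.proj (R := ℂ) (φ := fun _ : Fin c => ℂ) j).smulRight (φ j)

theorem rowC_apply (φ : Fin c → PhaseSpace τ n) (x : Fin c → ℂ) : rowC φ x = ∑ j, x j • φ j := by
  simp [rowC]

theorem rowC_mulVec (φ : Fin c → PhaseSpace τ n) (B : Matrix (Fin c) (Fin c) ℂ)
    (x : Fin c → ℂ) : rowC φ (B *ᵥ x) = ∑ j, x j • ∑ i, B i j • φ i := by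
  simp only [rowC_apply, Matrix.mulVec, dotProduct, Finset.sum_smul (M := PhaseSpace τ n),
    Finset.smul_sum, smul_smul]
  rw [Finset.sum_comm]
  simp only [mul_comm]

end Row

section Characteristics

variable {τ : ℝ} [hτ : Fact (0 < τ)] {n c : ℕ}

/-- A solution of `∂ₜ u = ∂_θ u` has derivative zero along the characteristics `t + θ = a`. -/
theorem hasDerivWithinAt_characteristic {u : ℝ → PhaseSpace τ n} {v : PhaseSpace τ n} {s a : ℝ}
    {I : Set ℝ} (hs : s ∈ I) (hu : HasDerivWithinAt u v I s) (hC : (u s, v) ∈ C1 τ n)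
    (hI : ∀ r ∈ I, a - r ∈ Icc (-τ) (0 : ℝ)) :
    HasDerivWithinAt (fun r => extC (u r) (a - r)) 0 I s := by
  -- Split u(r) = [u(r) − u(s) − (r−s)v] + u(s) + (r−s)v and evaluate at a − r. The bracket is o(r −
  -- s) in the sup norm, and the other two terms have derivatives −v(a−s) and +v(a−s), which cancel.
  -- Only u(s) has to be C¹.
  have hA : HasDerivWithinAt (fun r => extC (u r - u s - (r - s) • v) (a - r)) 0 I s := by
    rw [hasDerivWithinAt_iff_isLittleO] at hu ⊢
    have h1 : (fun r => extC (u r - u s - (r - s) • v) (a - r)) =O[𝓝[I] s]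
        fun r => u r - u s - (r - s) • v :=
      Asymptotics.IsBigO.of_bound' (Eventually.of_forall fun r => norm_extC_le _ _)
    refine (h1.trans_isLittleO hu).congr_left fun r => ?_
    · have : extC (u s - u s - (s - s) • v) (a - s) = 0 := by
        rw [sub_self, sub_self, zero_smul ℝ v, sub_self]; rfl
      rw [this, sub_zero, smul_zero, sub_zero]
  have hB : HasDerivWithinAt (fun r => extC (u s) (a - r)) (-extC v (a - s)) I s := by
    have := (hC (a - s) (hI s hs)).scomp s ((hasDerivWithinAt_id s I).const_sub a) hI
    rwa [neg_one_smul] at this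
  have hD : HasDerivWithinAt (fun r => (r - s) • extC v (a - r)) (extC v (a - s)) I s := by
    rw [hasDerivWithinAt_iff_isLittleO]
    have hc : Continuous fun r => extC v (a - r) - extC v (a - s) := by
      have := continuous_extC v
      fun_prop
    have h1 : (fun r => extC v (a - r) - extC v (a - s)) =o[𝓝[I] s] fun _ => (1 : ℝ) := by
      rw [Asymptotics.isLittleO_one_iff]
      have := (hc.tendsto s).mono_left (nhdsWithin_le_nhds (s := I))
      rwa [sub_self] at this
    have h2 := (Asymptotics.isBigO_refl (fun r : ℝ => r - s) (𝓝[I] s)).smul_isLittleO h1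
    refine h2.congr (fun r => ?_) (fun r => by simp)
    rw [sub_self, zero_smul, sub_zero, smul_sub]
  have h := (hA.add hB).add hD
  rw [zero_add, neg_add_cancel] at h
  refine h.congr_of_mem (fun r _ => ?_) hs
  have : ∀ φ χ ζ : PhaseSpace τ n, ∀ b : ℝ, ∀ θ : ℝ,
      extC (φ - χ - b • ζ) θ = extC φ θ - extC χ θ - b • extC ζ θ := fun _ _ _ _ _ => rfl
  simp only [Pi.add_apply, this]
  abel

theorem extC_eq_of_characteristic {u v : ℝ → PhaseSpace τ n} {r t a : ℝ} (hrt : r ≤ t)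
    (hu : ∀ s ∈ Icc r t, HasDerivWithinAt u (v s) (Icc r t) s)
    (hC : ∀ s ∈ Icc r t, (u s, v s) ∈ C1 τ n)
    (hI : ∀ s ∈ Icc r t, a - s ∈ Icc (-τ) (0 : ℝ)) :
    extC (u t) (a - t) = extC (u r) (a - r) := by
  have h := fun s hs => hasDerivWithinAt_characteristic hs (hu s hs) (hC s hs) hI
  exact constant_of_has_deriv_right_zero (fun s hs => (h s hs).continuousWithinAt)
    (fun s hs => ((h s (Ico_subset_Icc_self hs)).mono_of_mem_nhdsWithin
      (Icc_mem_nhdsGE_of_mem hs))) t (right_mem_Icc.2 hrt)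

theorem sum_smul_mem_C1 (φ χ : Fin c → PhaseSpace τ n) (h : ∀ j, (φ j, χ j) ∈ C1 τ n)
    (x : Fin c → ℂ) : (∑ j, x j • φ j, ∑ j, x j • χ j) ∈ C1 τ n := by
  have := Submodule.sum_mem (C1 τ n) fun j (_ : j ∈ Finset.univ) =>
    Submodule.smul_mem (C1 τ n) (x j) (h j)
  convert this using 1
  ext1 <;> simp [Prod.fst_sum, Prod.snd_sum]

theorem rowC_mem_C1 {φ : Fin c → PhaseSpace τ n} {B : Matrix (Fin c) (Fin c) ℂ}
    (h : ∀ j, (φ j, ∑ i, B i j • φ i) ∈ C1 τ n) (x : Fin c → ℂ) :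
    (rowC φ x, rowC φ (B *ᵥ x)) ∈ C1 τ n := by
  rw [rowC_apply, rowC_mulVec]
  exact sum_smul_mem_C1 _ _ h x

end Characteristics

section LinearODE

variable {E : Type*} [NormedAddCommGroup E] [NormedSpace ℂ E]

/-- The solution `e^{tA} x` of `ẋ = A x`. -/
noncomputable def expFlow (A : E →L[ℂ] E) (t : ℝ) (x : E) : E := NormedSpace.exp (t • A) x

theorem expFlow_zero (A : E →L[ℂ] E) (x : E) : expFlow A 0 x = x := by
  simp [expFlow]

theorem hasDerivAt_expFlow [CompleteSpace E] (A : E →L[ℂ] E) (x : E) (t : ℝ) :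
    HasDerivAt (fun s => expFlow A s x) (A (expFlow A t x)) t := by
  have h := hasDerivAt_exp_smul_const' (𝕂 := ℝ) A t
  exact ((ContinuousLinearMap.apply ℂ E x).restrictScalars ℝ).hasFDerivAt.comp_hasDerivAt t h

end LinearODE

/-! ### The generator A₀ on C¹ functions -/

section Generator

variable {τ : ℝ} [hτ : Fact (0 < τ)] {n c : ℕ}

/-- A finite-dimensional space invariant under `A₀` carries the flow of a linear ODE. -/
theorem generator_rowC {L : PhaseSpace τ n →L[ℂ] (Fin n → ℂ)} {φ : Fin c → PhaseSpace τ n}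
    {B : Matrix (Fin c) (Fin c) ℂ} (h : ∀ j, (φ j, ∑ i, B i j • φ i) ∈ C1 τ n)
    (h0 : ∀ j, extC (∑ i, B i j • φ i) 0 = L (φ j)) (x : Fin c → ℂ) :
    Generator L (rowC φ x) (rowC φ (B *ᵥ x)) := by
  set A : (Fin c → ℂ) →L[ℂ] (Fin c → ℂ) := LinearMap.toContinuousLinearMap B.mulVecLin
  set u : ℝ → PhaseSpace τ n := fun t => rowC φ (expFlow A t x) with hu
  set v : ℝ → PhaseSpace τ n := fun t => rowC φ (B *ᵥ expFlow A t x) with hv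
  have hd : ∀ t, HasDerivAt u (v t) t := fun t =>
    ((rowC φ).restrictScalars ℝ).hasFDerivAt.comp_hasDerivAt t (hasDerivAt_expFlow A x t)
  have hC : ∀ t, (u t, v t) ∈ C1 τ n := fun t => rowC_mem_C1 h _
  have hL : ∀ t, extC (v t) 0 = L (u t) := fun t => by
    simp only [hu, hv]
    rw [rowC_mulVec, rowC_apply]
    simp only [map_sum, map_smul, ← h0, ← evalC_apply]
  have hcont : Continuous u := continuous_iff_continuousAt.2 fun t => (hd t).continuousAt
  let z : C(ℝ, Fin n → ℂ) := ⟨fun t => extC (u t) 0,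
    (evalC (n := n) (τ := τ) 0).continuous.comp hcont⟩
  -- The flow u exists for all real times, so the characteristic through (t, θ) can be followed back
  -- to the boundary point (t+θ, 0) whatever the sign of t+θ.
  have hz : ∀ t, histSegment τ z t = u t := fun t => by
    refine phaseSpace_ext fun θ hθ => ?_
    have h1 := extC_eq_of_characteristic (u := u) (v := v) (r := t + θ) (t := t) (a := t + θ)
      (by linarith [hθ.2]) (fun s _ => (hd s).hasDerivWithinAt) (fun s _ => hC s)
      (fun s hs => ⟨by linarith [hs.2, hθ.1], by linarith [hs.1]⟩)
    rw [add_sub_cancel_left, sub_self] at h1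
    rw [h1]
    exact extC_coe (histSegment τ z t) ⟨θ, hθ⟩
  have hu0 : u 0 = rowC φ x := by simp only [hu, expFlow_zero]
  refine ⟨z, ⟨(hz 0).trans hu0, fun t _ => ?_⟩, ?_⟩
  · rw [hz, ← hL]
    exact (((evalC (n := n) (τ := τ) 0).restrictScalars ℝ).hasFDerivAt.comp_hasDerivAt t
      (hd t)).hasDerivWithinAt
  · have h1 := (hasDerivWithinAt_iff_tendsto_slope' (self_notMem_Ioi (a := (0 : ℝ)))).1
      (hd 0).hasDerivWithinAt
    have hv0 : v 0 = rowC φ (B *ᵥ x) := by simp only [hv, expFlow_zero]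
    rw [← hv0, ← hu0]
    refine h1.congr fun t => ?_
    rw [slope_def_module, sub_zero, hz]

theorem tendsto_inv_smul_of_hasDerivWithinAt {F : Type*} [NormedAddCommGroup F]
    [NormedSpace ℝ F] {g : ℝ → F} {g' : F} (h : HasDerivWithinAt g g' (Ioi 0) 0) :
    Tendsto (fun t : ℝ => t⁻¹ • (g t - g 0)) (𝓝[>] 0) (𝓝 g') := by
  have h1 := (hasDerivWithinAt_iff_tendsto_slope' (self_notMem_Ioi (a := (0 : ℝ)))).1 h
  refine h1.congr fun t => ?_
  rw [slope_def_module, sub_zero]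

/-- On `C¹` functions the generator `A₀` is differentiation, and its domain is given by
`φ̇(0) = L φ`. -/
theorem Generator.eq_deriv {L : PhaseSpace τ n →L[ℂ] (Fin n → ℂ)} {φ χ φ' : PhaseSpace τ n}
    (h : Generator L φ χ) (hφ : (φ, φ') ∈ C1 τ n) : χ = φ' ∧ extC φ' 0 = L φ := by
  obtain ⟨z, ⟨hz0, hz⟩, hlim⟩ := h
  have hzφ : ∀ θ ∈ Icc (-τ) (0 : ℝ), z θ = extC φ θ := fun θ hθ => by
    rw [← hz0, extC_coe _ ⟨θ, hθ⟩]
    simp [histSegment]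
  have hev : ∀ θ ∈ Icc (-τ) (0 : ℝ),
      Tendsto (fun t : ℝ => t⁻¹ • (z (t + θ) - z (0 + θ))) (𝓝[>] 0) (𝓝 (extC χ θ)) := by
    intro θ hθ
    have h1 := ((evalC (n := n) (τ := τ) θ).continuous.tendsto χ).comp hlim
    refine h1.congr fun t => ?_
    change t⁻¹ • (extC (histSegment τ z t) θ - extC φ θ) = _
    rw [zero_add, hzφ θ hθ, extC_coe _ ⟨θ, hθ⟩]
    rfl
  have hθ : ∀ θ ∈ Ico (-τ) (0 : ℝ), extC χ θ = extC φ' θ := by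
    intro θ hθ
    refine tendsto_nhds_unique (hev θ (Ico_subset_Icc_self hθ))
      (tendsto_inv_smul_of_hasDerivWithinAt (g := fun t => z (t + θ)) ?_)
    have h1 : HasDerivWithinAt (extC φ) (extC φ' (0 + θ)) (Ici (0 + θ)) (0 + θ) := by
      rw [zero_add]
      exact (hφ θ (Ico_subset_Icc_self hθ)).mono_of_mem_nhdsWithin (Icc_mem_nhdsGE_of_mem hθ)
    have h2 : HasDerivWithinAt z (extC φ' (0 + θ)) (Ici (0 + θ)) (0 + θ) := by
      refine h1.congr_of_eventuallyEq ?_ (by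
        rw [zero_add]; exact hzφ θ (Ico_subset_Icc_self hθ))
      rw [zero_add]
      filter_upwards [Icc_mem_nhdsGE_of_mem hθ] with s hs using hzφ s hs
    have h3 := h2.scomp 0 ((hasDerivWithinAt_id (0 : ℝ) (Ioi 0)).add_const θ)
      (fun t ht => by simpa using (le_of_lt ht : (0 : ℝ) ≤ t))
    rwa [one_smul, zero_add] at h3
  -- At θ = 0 the right difference quotients see the delay equation instead of φ. Hence χ(0) = φ'(0)
  -- comes from continuity, and comparison with the quotient at 0 then yields the boundary
  -- condition.
  have hall : EqOn (extC χ) (extC φ') (Icc (-τ) 0) := by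
    have h1 : EqOn (extC χ) (extC φ') (closure (Ico (-τ) 0)) :=
      EqOn.closure hθ (continuous_extC χ) (continuous_extC φ')
    rwa [closure_Ico (by linarith [hτ.out])] at h1
  have h00 : (0 : ℝ) ∈ Icc (-τ) (0 : ℝ) := ⟨by linarith [hτ.out], le_rfl⟩
  refine ⟨phaseSpace_ext hall, ?_⟩
  rw [← hall h00]
  refine tendsto_nhds_unique (hev 0 h00) (tendsto_inv_smul_of_hasDerivWithinAt
    (g := fun t => z (t + 0)) ?_)
  have h1 := (hz 0 self_mem_Ici).mono Ioi_subset_Ici_self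
  rw [hz0] at h1
  simpa only [add_zero] using h1

end Generator

/-! ### The matrix B on P, and rows intertwining B with A₀ -/

namespace Splitting

variable {τ : ℝ} [hτ : Fact (0 < τ)] {n c p : ℕ} (S : Splitting τ n c)

theorem Phi_mem_C1 (j : Fin c) : (S.Phi j, ∑ i, S.B i j • S.Phi i) ∈ C1 τ n := fun θ hθ => by
  refine (S.deriv_Phi j θ hθ).congr_deriv ?_
  simp only [← evalC_apply, map_sum, map_smul]

theorem PhiL_mem_C1 (x : Fin c → ℂ) : (S.PhiL x, S.PhiL (S.B *ᵥ x)) ∈ C1 τ n :=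
  rowC_mem_C1 S.Phi_mem_C1 x

theorem PhiL_injective : Function.Injective S.PhiL := fun x y h => by
  rw [← S.coef_PhiL x, h, S.coef_PhiL]

theorem exists_PhiL_eq {v : PhaseSpace τ n}
    (hv : v ∈ generalizedEigenspace (Generator S.L₀) S.Lam) : ∃ x, S.PhiL x = v := by
  rw [← S.Phi_span, Submodule.mem_span_range_iff_exists_fun] at hv
  obtain ⟨x, hx⟩ := hv
  exact ⟨x, by rw [S.PhiL_apply]; exact hx⟩

/-- Members of ker (A₀ − λ)^k lie in P, where A₀ is differentiation and hence acts on coordinates as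
B; injectivity of Φ transfers the power. The relation Φ̇ = ΦB alone does not give φ̇(0) = L₀φ, so
the boundary condition is read off from membership in the domain of A₀ and carried along. -/
theorem exists_PhiL_of_inKerPow {lam : ℂ} (hlam : lam ∈ S.Lam) (k : ℕ) {v : PhaseSpace τ n}
    (hv : InKerPow (Generator S.L₀) lam k v) :
    ∃ x, S.PhiL x = v ∧ ((S.B.mulVecLin - lam • (1 : Module.End ℂ (Fin c → ℂ))) ^ k) x = 0 ∧
      extC (S.PhiL (S.B *ᵥ x)) 0 = S.L₀ (S.PhiL x) := by
  induction k generalizing v with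
  | zero =>
    obtain rfl : v = 0 := hv
    exact ⟨0, map_zero _, map_zero _, by simp⟩
  | succ k ih =>
    obtain ⟨x, rfl⟩ := S.exists_PhiL_eq (Submodule.subset_span ⟨lam, hlam, k + 1, hv⟩)
    obtain ⟨w, hw, hk⟩ := hv
    obtain ⟨rfl, h0⟩ := hw.eq_deriv (S.PhiL_mem_C1 x)
    obtain ⟨y, hy, hyk, -⟩ := ih hk
    rw [← map_smul, ← map_sub] at hy
    refine ⟨x, rfl, ?_, h0⟩
    rw [S.PhiL_injective hy] at hyk
    rw [pow_succ]
    exact hyk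

/-- P is by definition the span of the generalized eigenvectors, so their coordinates span ℂ^c.
Consequently any linear property of x need only be checked on generalized eigenvectors of B for Λ
that satisfy the boundary condition. -/
theorem mem_span_genEigen (x : Fin c → ℂ) :
    x ∈ Submodule.span ℂ {x : Fin c → ℂ |
      (∃ lam ∈ S.Lam, ∃ k, ((S.B.mulVecLin - lam • (1 : Module.End ℂ (Fin c → ℂ))) ^ k) x = 0) ∧
      extC (S.PhiL (S.B *ᵥ x)) 0 = S.L₀ (S.PhiL x)} := by
  set G := Submodule.span ℂ {x : Fin c → ℂ |
      (∃ lam ∈ S.Lam, ∃ k, ((S.B.mulVecLin - lam • (1 : Module.End ℂ (Fin c → ℂ))) ^ k) x = 0) ∧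
      extC (S.PhiL (S.B *ᵥ x)) 0 = S.L₀ (S.PhiL x)} with hG
  have h1 : generalizedEigenspace (Generator S.L₀) S.Lam ≤ G.map S.PhiL.toLinearMap := by
    refine Submodule.span_le.2 ?_
    rintro v ⟨lam, hlam, k, hk⟩
    obtain ⟨y, hy, hyk, hy0⟩ := S.exists_PhiL_of_inKerPow hlam k hk
    exact ⟨y, Submodule.subset_span ⟨⟨lam, hlam, k, hyk⟩, hy0⟩, hy⟩
  have h2 : S.PhiL x ∈ generalizedEigenspace (Generator S.L₀) S.Lam := by
    rw [← S.Phi_span, S.PhiL_apply]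
    exact Submodule.sum_mem _ fun j _ =>
      Submodule.smul_mem _ _ (Submodule.subset_span (mem_range_self j))
  obtain ⟨y, hy, hyx⟩ := h1 h2
  rwa [← S.PhiL_injective hyx]

/-- `P` lies in the domain of `A₀`. -/
theorem extC_PhiL_B (x : Fin c → ℂ) : extC (S.PhiL (S.B *ᵥ x)) 0 = S.L₀ (S.PhiL x) := by
  have := S.mem_span_genEigen x
  induction this using Submodule.span_induction with
  | mem x hx => exact hx.2
  | zero => simp
  | add x y _ _ hx hy => simp [Matrix.mulVec_add, hx, hy]
  | smul a x _ hx => simp [Matrix.mulVec_smul, hx]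

/-- A row in `Q¹` on which `A₀` acts like `B` on `Φ` vanishes, since it lies in `P ∩ Q`. -/
theorem row_eq_zero (y : Fin c → S.Q1) (h : ∀ j, S.dot (y j) = ∑ i, S.B i j • S.fn (y i))
    (h0 : ∀ j, extC (S.dot (y j)) 0 = S.L₀ (S.fn (y j))) (j : Fin c) : S.fn (y j) = 0 := by
  have hC : ∀ j, (S.fn (y j), ∑ i, S.B i j • S.fn (y i)) ∈ C1 τ n := fun j => by
    rw [← h j]; exact (y j).2.1
  have hgen := generator_rowC (L := S.L₀) hC fun j => by rw [← h j]; exact h0 j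
  set r := rowC fun j => S.fn (y j) with hr
  -- The map r intertwines B with A₀, so it carries generalized eigenvectors of B to generalized
  -- eigenvectors of A₀; its injectivity plays no role.
  have hker : ∀ lam k x, ((S.B.mulVecLin - lam • (1 : Module.End ℂ (Fin c → ℂ))) ^ k) x = 0 →
      InKerPow (Generator S.L₀) lam k (r x) := by
    intro lam k
    induction k with
    | zero => intro x hx; obtain rfl : x = 0 := hx; exact map_zero r
    | succ k ih =>
      intro x hx
      refine ⟨_, hgen x, ?_⟩
      rw [← map_smul, ← map_sub]
      rw [pow_succ] at hx
      exact ih _ hx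
  have hmem : ∀ x, r x ∈ generalizedEigenspace (Generator S.L₀) S.Lam := fun x => by
    have := S.mem_span_genEigen x
    induction this using Submodule.span_induction with
    | mem x hx =>
      obtain ⟨⟨lam, hlam, k, hk⟩, -⟩ := hx
      exact Submodule.subset_span ⟨lam, hlam, k, hker lam k x hk⟩
    | zero => rw [map_zero]; exact zero_mem _
    | add x y _ _ hx hy => rw [map_add]; exact add_mem hx hy
    | smul a x _ hx => rw [map_smul]; exact Submodule.smul_mem _ a hx
  -- The entry y_j is the image of the j-th unit vector, hence equals Φx for some x. Pairing with Ψ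
  -- gives x = 0 because y_j lies in Q.
  obtain ⟨x, hx⟩ := S.exists_PhiL_eq (hmem (Pi.single j 1))
  have hrj : r (Pi.single j 1) = S.fn (y j) := by
    rw [hr, rowC_apply, Finset.sum_eq_single j]
    · rw [Pi.single_eq_same, one_smul]
    · intro i _ hi
      rw [Pi.single_eq_of_ne hi]
      exact zero_smul ℂ (S.fn (y i))
    · exact fun hj => absurd (Finset.mem_univ j) hj
  rw [hrj] at hx
  have hx0 := S.coef_fn (y j)
  rw [← hx, S.coef_PhiL] at hx0
  rw [← hx, hx0, map_zero]

end Splitting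

/-! ### Finite-rank perturbations, affine equations and the space C¹ -/

section FiniteRank

/-- A perturbation of a surjective linear map by a map that factors through a finite-dimensional
space is surjective as soon as it is injective. -/
theorem LinearMap.surjective_add_of_injective {K V W F : Type*} [Field K] [AddCommGroup V]
    [Module K V] [AddCommGroup W] [Module K W] [AddCommGroup F] [Module K F]
    [FiniteDimensional K F] {T : V →ₗ[K] W} (hT : Function.Surjective T) (J : F →ₗ[K] W)
    (R : V →ₗ[K] F) (hinj : ∀ v, (T + J ∘ₗ R) v = 0 → v = 0) :
    Function.Surjective (T + J ∘ₗ R) := by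
  obtain ⟨G, hG⟩ := T.exists_rightInverse_of_surjective (LinearMap.range_eq_top.2 hT)
  have hinj' : Function.Injective (T + J ∘ₗ R) := (injective_iff_map_eq_zero _).2 hinj
  have hTG : ∀ w, T (G w) = w := fun w => LinearMap.congr_fun hG w
  have hM : ∀ w, (T + J ∘ₗ R) (G w) = w + J (R (G w)) := fun w => by simp [hTG]
  -- With G a right inverse of T, the map (T + JR)G = 1 + JRG preserves the finite-dimensional range
  -- of J. Injectivity there implies surjectivity.
  let M : J.range →ₗ[K] J.range :=
    { toFun := fun u => ⟨u + J (R (G u)), add_mem u.2 (LinearMap.mem_range_self J _)⟩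
      map_add' := fun u v => by ext; simp; abel
      map_smul' := fun a u => by ext; simp }
  have hMinj : Function.Injective M := fun u v huv => by
    have h1 : (T + J ∘ₗ R) (G u) = (T + J ∘ₗ R) (G v) := by
      rw [hM, hM]; exact congrArg Subtype.val huv
    have h2 := congrArg T (hinj' h1)
    rw [hTG, hTG] at h2
    exact Subtype.ext h2
  intro y
  obtain ⟨z, hz⟩ := LinearMap.injective_iff_surjective.1 hMinj
    ⟨J (R (G y)), LinearMap.mem_range_self J _⟩
  have hz' : (z : W) + J (R (G z)) = J (R (G y)) := congrArg Subtype.val hz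
  -- The image is y − z + JRG y − JRG z, which is y because z + JRG z = JRG y.
  refine ⟨G (y - z), ?_⟩
  rw [hM, map_sub, map_sub, map_sub, ← hz']
  abel

/-- The form needed for operators defined on all pairs (φ, χ) but solved only within the subspace of
pairs with χ = φ̇. -/
theorem LinearMap.surjOn_add_of_injOn {K E W F : Type*} [Field K] [AddCommGroup E]
    [Module K E] [AddCommGroup W] [Module K W] [AddCommGroup F] [Module K F]
    [FiniteDimensional K F] (V : Submodule K E) (T : E →ₗ[K] W) (hT : ∀ w, ∃ v ∈ V, T v = w)
    (J : F →ₗ[K] W) (R : E →ₗ[K] F) (hinj : ∀ v ∈ V, T v + J (R v) = 0 → v = 0) (w : W) :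
    ∃ v ∈ V, T v + J (R v) = w := by
  obtain ⟨v, hv⟩ := LinearMap.surjective_add_of_injective (T := T ∘ₗ V.subtype)
    (fun w => by obtain ⟨v, hv, h⟩ := hT w; exact ⟨⟨v, hv⟩, h⟩) J (R ∘ₗ V.subtype)
    (fun v hv => Subtype.ext (hinj v v.2 hv)) w
  exact ⟨v, v.2, hv⟩

end FiniteRank

section AffineODE

variable {E : Type*} [NormedAddCommGroup E] [NormedSpace ℂ E] [CompleteSpace E]

theorem expFlow_neg (A : E →L[ℂ] E) (t : ℝ) (x : E) : expFlow A t (expFlow (-A) t x) = x := by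
  let : NormedAlgebra ℚ (E →L[ℂ] E) := NormedAlgebra.restrictScalars ℚ ℂ _
  have h : NormedSpace.exp (t • A) * NormedSpace.exp (t • (-A)) = 1 := by
    rw [smul_neg, ← NormedSpace.exp_add_of_commute (Commute.neg_right (Commute.refl (t • A))),
      add_neg_cancel, NormedSpace.exp_zero]
  exact DFunLike.congr_fun h x

/-- Variation of constants. -/
theorem exists_hasDerivAt_affine (A : E →L[ℂ] E) {X : ℝ → E} (hX : Continuous X) (μ : E) :
    ∃ g : ℝ → E, g 0 = μ ∧ ∀ t, HasDerivAt g (A (g t) + X t) t := by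
  have hE : Continuous fun s : ℝ => NormedSpace.exp (s • (-A)) :=
    continuous_iff_continuousAt.2 fun s => (hasDerivAt_exp_smul_const' (𝕂 := ℝ) (-A) s).continuousAt
  have hEX : Continuous fun s : ℝ => expFlow (-A) s (X s) := hE.clm_apply hX
  refine ⟨fun t => expFlow A t (μ + ∫ s in (0 : ℝ)..t, expFlow (-A) s (X s)), ?_, fun t => ?_⟩
  · simp [expFlow_zero]
  · have h2 := (hEX.integral_hasStrictDerivAt 0 t).hasDerivAt.const_add μ
    have h1 : HasDerivAt (fun t : ℝ => (NormedSpace.exp (t • A)).restrictScalars ℝ)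
        ((A * NormedSpace.exp (t • A)).restrictScalars ℝ) t :=
      (ContinuousLinearMap.restrictScalarsL ℂ E E ℝ ℝ).hasFDerivAt.comp_hasDerivAt t
        (hasDerivAt_exp_smul_const' (𝕂 := ℝ) A t)
    refine (h1.clm_apply h2).congr_deriv ?_
    exact congrArg _ (expFlow_neg A t (X t))

end AffineODE

theorem sum_smul_inl {τ : ℝ} {n c : ℕ} (b : Fin c → ℂ) (φ : Fin c → PhaseSpace τ n) :
    ((∑ i, b i • φ i, 0) : JumpSpace τ n) = ∑ i, b i • (φ i, 0) := by
  ext1 <;> simp [Prod.fst_sum, Prod.snd_sum]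

section C1

variable {τ : ℝ} [hτ : Fact (0 < τ)] {n c : ℕ}

theorem C1_ext {f g : PhaseSpace τ n × PhaseSpace τ n} (hf : f ∈ C1 τ n) (hg : g ∈ C1 τ n)
    (h : f.1 = g.1) : f = g := by
  refine Prod.ext h (phaseSpace_ext fun θ hθ => ?_)
  have h1 := hf θ hθ
  rw [h] at h1
  exact (uniqueDiffOn_Icc (by linarith [hτ.out]) θ hθ).eq_deriv _ h1 (hg θ hθ)

/-- The integral form involves only continuous functions of the pair, so it shows that C¹ is closed
in C × C; completeness of Q¹ rests on this. -/
theorem mem_C1_iff {f : PhaseSpace τ n × PhaseSpace τ n} :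
    f ∈ C1 τ n ↔ ∀ θ ∈ Icc (-τ) (0 : ℝ),
      extC f.1 θ = extC f.1 0 + ∫ s in (0 : ℝ)..θ, extC f.2 s := by
  constructor
  · intro hf θ hθ
    have h := intervalIntegral.integral_eq_sub_of_hasDerivAt_of_le hθ.2
      (f := extC f.1) (f' := extC f.2) (continuous_extC f.1).continuousOn (fun s hs =>
        (hf s ⟨hθ.1.trans hs.1.le, hs.2.le⟩).hasDerivAt
          (Icc_mem_nhds (hθ.1.trans_lt hs.1) hs.2)) ((continuous_extC f.2).intervalIntegrable _ _)
    rw [intervalIntegral.integral_symm, h]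
    abel
  · intro h θ hθ
    have h1 := ((continuous_extC f.2).integral_hasStrictDerivAt 0 θ).hasDerivAt
    exact ((h1.const_add (extC f.1 0)).hasDerivWithinAt).congr h (h θ hθ)

theorem isClosed_C1 : IsClosed (C1 τ n : Set (PhaseSpace τ n × PhaseSpace τ n)) := by
  have h : (C1 τ n : Set (PhaseSpace τ n × PhaseSpace τ n)) = ⋂ θ ∈ Icc (-τ) (0 : ℝ),
      {f | extC f.1 θ = extC f.1 0 + ∫ s in (0 : ℝ)..θ, extC f.2 s} := by
    ext f
    simp only [SetLike.mem_coe, mem_C1_iff, mem_iInter, mem_ofPred_eq]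
  rw [h]
  refine isClosed_biInter fun θ _ => isClosed_eq ?_ ?_
  · exact (evalC (n := n) (τ := τ) θ).continuous.comp continuous_fst
  · refine ((evalC (n := n) (τ := τ) 0).continuous.comp continuous_fst).add ?_
    let I : PhaseSpace τ n →ₗ[ℂ] (Fin n → ℂ) :=
      { toFun := fun φ => ∫ s in (0 : ℝ)..θ, extC φ s
        map_add' := fun φ χ => intervalIntegral.integral_add
          ((continuous_extC φ).intervalIntegrable _ _) ((continuous_extC χ).intervalIntegrable _ _)
        map_smul' := fun a φ => intervalIntegral.integral_smul a _ }
    have hI : Continuous I := AddMonoidHomClass.continuous_of_bound I |θ| fun φ => by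
      have := intervalIntegral.norm_integral_le_of_norm_le_const (a := (0 : ℝ)) (b := θ)
        (f := extC φ) (C := ‖φ‖) (fun s _ => norm_extC_le φ s)
      rwa [sub_zero, mul_comm] at this
    exact hI.comp continuous_snd

/-- The inhomogeneous linear equation `φ̇ = φ B + χ`, `φ(0) = μ` is solvable on `[-τ,0]`. -/
theorem exists_row_solution (B : Matrix (Fin c) (Fin c) ℂ) (χ : Fin c → PhaseSpace τ n)
    (μ : Fin c → Fin n → ℂ) : ∃ φ : Fin c → PhaseSpace τ n,
      (∀ j, (φ j, (∑ i, B i j • φ i) + χ j) ∈ C1 τ n) ∧ ∀ j, extC (φ j) 0 = μ j := by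
  let A₀ : (Fin c → Fin n → ℂ) →ₗ[ℂ] (Fin c → Fin n → ℂ) :=
    { toFun := fun f j => ∑ i, B i j • f i
      map_add' := fun f g => by
        funext j; simp only [Pi.add_apply, smul_add, Finset.sum_add_distrib]
      map_smul' := fun a f => by
        funext j
        simp only [Pi.smul_apply, Finset.smul_sum, RingHom.id_apply]
        exact Finset.sum_congr rfl fun i _ => smul_comm _ _ _ }
  set A : (Fin c → Fin n → ℂ) →L[ℂ] (Fin c → Fin n → ℂ) := LinearMap.toContinuousLinearMap A₀
  let X : ℝ → Fin c → Fin n → ℂ := fun s j => extC (χ j) s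
  have hX : Continuous X := continuous_pi fun j => continuous_extC (χ j)
  obtain ⟨g, hg0, hg⟩ := exists_hasDerivAt_affine A hX μ
  have hgc : Continuous g := continuous_iff_continuousAt.2 fun t => (hg t).continuousAt
  let φ : Fin c → PhaseSpace τ n := fun j => ⟨fun θ => g θ j, by fun_prop⟩
  have hφ : ∀ j, ∀ θ ∈ Icc (-τ) (0 : ℝ), extC (φ j) θ = g θ j := fun j θ hθ =>
    extC_coe (φ j) ⟨θ, hθ⟩
  refine ⟨φ, fun j θ hθ => ?_, fun j => ?_⟩
  · have h1 := (hasDerivAt_pi.1 (hg θ) j).hasDerivWithinAt (s := Icc (-τ) 0)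
    refine (h1.congr (hφ j) (hφ j θ hθ)).congr_deriv ?_
    simp only [← evalC_apply, map_add, map_sum, map_smul]
    simp only [evalC_apply, hφ _ θ hθ]
    rfl
  · rw [hφ j 0 ⟨by linarith [hτ.out], le_rfl⟩]
    rw [hg0]

end C1

/-! ### Bijectivity of h ↦ A h − h B from (Q¹)^c onto (ker π)^c -/

namespace Splitting

variable {τ : ℝ} [hτ : Fact (0 < τ)] {n c p : ℕ} (S : Splitting τ n c)

theorem mem_Q1_iff {f : PhaseSpace τ n × PhaseSpace τ n} :
    f ∈ S.Q1 ↔ f ∈ C1 τ n ∧ S.coef (f.1, 0) = 0 := by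
  refine and_congr_right fun _ => ?_
  rw [funext_iff]
  exact forall_congr' fun i => by simp [coef_apply]

theorem isClosed_Q1 : IsClosed (S.Q1 : Set (PhaseSpace τ n × PhaseSpace τ n)) := by
  have h : (S.Q1 : Set (PhaseSpace τ n × PhaseSpace τ n)) =
      (C1 τ n : Set _) ∩ {f | S.coef (f.1, 0) = 0} := by
    ext f; exact S.mem_Q1_iff
  rw [h]
  exact isClosed_C1.inter (isClosed_eq (by fun_prop) continuous_const)

instance : CompleteSpace S.Q1 := S.isClosed_Q1.completeSpace_coe

/-- `φ ↦ φ̇ + X₀ [L₀ φ - φ̇(0)]` on pairs `(φ, φ̇)`. -/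
noncomputable def dL : PhaseSpace τ n × PhaseSpace τ n →L[ℂ] JumpSpace τ n :=
  (ContinuousLinearMap.snd ℂ _ _).prod
    (S.L₀ ∘L ContinuousLinearMap.fst ℂ _ _ - evalC 0 ∘L ContinuousLinearMap.snd ℂ _ _)

theorem dL_apply (f : PhaseSpace τ n × PhaseSpace τ n) :
    S.dL f = (f.2, S.L₀ f.1 - extC f.2 0) := rfl

/-- The operator `φ ↦ A φ - φ B` on rows of pairs `(φ, φ̇)`. -/
noncomputable def rowOp :
    (Fin c → PhaseSpace τ n × PhaseSpace τ n) →L[ℂ] (Fin c → JumpSpace τ n) :=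
  ContinuousLinearMap.pi fun j => S.dL ∘L ContinuousLinearMap.proj j -
    ContinuousLinearMap.inl ℂ _ _ ∘L
      ∑ i, S.B i j • (ContinuousLinearMap.fst ℂ _ _ ∘L ContinuousLinearMap.proj i)

theorem rowOp_apply (f : Fin c → PhaseSpace τ n × PhaseSpace τ n) (j : Fin c) :
    S.rowOp f j = S.dL (f j) - (∑ i, S.B i j • (f i).1, 0) := by
  have e := sum_smul_inl (fun i => S.B i j) fun i => (f i).1
  simp [rowOp, e]

theorem coef_rowOp (f : Fin c → PhaseSpace τ n × PhaseSpace τ n) (hf : ∀ j, f j ∈ S.Q1)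
    (j : Fin c) : S.coef (S.rowOp f j) = 0 := by
  have h : ∀ i, S.coef ((f i).1, 0) = 0 := fun i => (S.mem_Q1_iff.1 (hf i)).2
  rw [rowOp_apply, map_sub, dL_apply, S.coef_deriv (hf j), sum_smul_inl]
  simp only [map_sum, map_smul, h, smul_zero, Finset.sum_const_zero, sub_zero]

/-- The two components of A h = h B say ḣ = hB and ḣ(0) = L₀h, which are the hypotheses of
`row_eq_zero`. -/
theorem rowOp_injective (f : Fin c → PhaseSpace τ n × PhaseSpace τ n) (hf : ∀ j, f j ∈ S.Q1)
    (h : S.rowOp f = 0) : f = 0 := by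
  have h1 : ∀ j, (f j).2 = ∑ i, S.B i j • (f i).1 ∧ S.L₀ (f j).1 - extC (f j).2 0 = 0 :=
    fun j => by
      have := congrFun h j
      rw [rowOp_apply, dL_apply] at this
      have h2 := Prod.ext_iff.1 this
      exact ⟨sub_eq_zero.1 h2.1, by simpa using h2.2⟩
  funext j
  refine C1_ext (hf j).1 (zero_mem _) ?_
  exact S.row_eq_zero (fun j => ⟨f j, hf j⟩) (fun j => (h1 j).1)
    (fun j => (sub_eq_zero.1 (h1 j).2).symm) j

/-- The lift `(Φ x, Φ B x)` of `P` to `C¹`. -/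
noncomputable def PhiC : (Fin c → ℂ) →L[ℂ] PhaseSpace τ n × PhaseSpace τ n :=
  S.PhiL.prod (S.PhiL ∘L LinearMap.toContinuousLinearMap S.B.mulVecLin)

/-- The operator `φ ↦ (φ̇ - φ B) + X₀ φ(0)` on rows of pairs `(φ, φ̇)`. -/
noncomputable def rowOde :
    (Fin c → PhaseSpace τ n × PhaseSpace τ n) →L[ℂ] (Fin c → JumpSpace τ n) :=
  ContinuousLinearMap.pi fun j =>
    ((ContinuousLinearMap.snd ℂ _ _).prod (evalC 0 ∘L ContinuousLinearMap.fst ℂ _ _)) ∘L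
      ContinuousLinearMap.proj j -
    ContinuousLinearMap.inl ℂ _ _ ∘L
      ∑ i, S.B i j • (ContinuousLinearMap.fst ℂ _ _ ∘L ContinuousLinearMap.proj i)

theorem rowOde_apply (f : Fin c → PhaseSpace τ n × PhaseSpace τ n) (j : Fin c) :
    S.rowOde f j = ((f j).2, extC (f j).1 0) - (∑ i, S.B i j • (f i).1, 0) := by
  have e := sum_smul_inl (fun i => S.B i j) fun i => (f i).1
  simp [rowOde, e, evalC_apply]

/-- The boundary values by which `rowOp` and `rowOde` differ, and the coordinates of the
projection to `P`. -/
noncomputable def rowTrace : (Fin c → PhaseSpace τ n × PhaseSpace τ n) →L[ℂ]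
    (Fin c → Fin n → ℂ) × (Fin c → Fin c → ℂ) :=
  (ContinuousLinearMap.pi fun j => (S.L₀ ∘L ContinuousLinearMap.fst ℂ _ _
    - evalC 0 ∘L ContinuousLinearMap.snd ℂ _ _ - evalC 0 ∘L ContinuousLinearMap.fst ℂ _ _) ∘L
      ContinuousLinearMap.proj j).prod
  (ContinuousLinearMap.pi fun j => S.coef ∘L ContinuousLinearMap.inl ℂ _ _ ∘L
    ContinuousLinearMap.fst ℂ _ _ ∘L ContinuousLinearMap.proj j)

theorem rowTrace_apply (f : Fin c → PhaseSpace τ n × PhaseSpace τ n) :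
    S.rowTrace f = (fun j => S.L₀ (f j).1 - extC (f j).2 0 - extC (f j).1 0,
      fun j => S.coef ((f j).1, 0)) := rfl

/-- The finite-rank correction turning `rowOde` into an operator that agrees with `rowOp` on `Q¹`
and is the identity on `P`. -/
noncomputable def rowCorrection : (Fin c → Fin n → ℂ) × (Fin c → Fin c → ℂ) →L[ℂ]
    (Fin c → JumpSpace τ n) :=
  (ContinuousLinearMap.pi fun j => ContinuousLinearMap.inr ℂ _ _ ∘L
    ContinuousLinearMap.proj j) ∘L ContinuousLinearMap.fst ℂ _ _
  + ((ContinuousLinearMap.pi fun j => ContinuousLinearMap.inl ℂ _ _ ∘L S.PhiL ∘L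
      ContinuousLinearMap.proj j)
    - S.rowOp ∘L (ContinuousLinearMap.pi fun j => S.PhiC ∘L ContinuousLinearMap.proj j))
    ∘L ContinuousLinearMap.snd ℂ _ _

theorem rowCorrection_apply (m : Fin c → Fin n → ℂ) (x : Fin c → Fin c → ℂ) :
    S.rowCorrection (m, x) = (fun j => (0, m j)) + ((fun j => (S.PhiL (x j), 0))
      - S.rowOp fun j => S.PhiC (x j)) := rfl

/-- Splitting f into its Q¹ part and its P part, the corrected operator is A h − h B on the first
and the identity on the second. The trace takes values in a finite-dimensional space, so the
correction has finite rank. -/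
theorem rowOde_add_rowCorrection (f : Fin c → PhaseSpace τ n × PhaseSpace τ n) :
    S.rowOde f + S.rowCorrection (S.rowTrace f) =
      S.rowOp (fun j => f j - S.PhiC (S.coef ((f j).1, 0)))
        + fun j => (S.PhiL (S.coef ((f j).1, 0)), 0) := by
  have e : (fun j => f j - S.PhiC (S.coef ((f j).1, 0)))
      = f - fun j => S.PhiC (S.coef ((f j).1, 0)) := rfl
  have e2 : S.rowOde f + (fun j => ((0, S.L₀ (f j).1 - extC (f j).2 0 - extC (f j).1 0) :
      JumpSpace τ n)) = S.rowOp f := by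
    funext j
    rw [rowOp_apply, Pi.add_apply, rowOde_apply, dL_apply]
    ext1 <;> simp
  rw [rowTrace_apply, rowCorrection_apply, e, map_sub, ← e2]
  abel

theorem sub_PhiC_mem_Q1 {f : PhaseSpace τ n × PhaseSpace τ n} (hf : f ∈ C1 τ n) :
    f - S.PhiC (S.coef (f.1, 0)) ∈ S.Q1 := by
  refine S.mem_Q1_iff.2 ⟨sub_mem hf (S.PhiL_mem_C1 _), ?_⟩
  have e : (((f - S.PhiC (S.coef (f.1, 0))).1, 0) : JumpSpace τ n)
      = (f.1, 0) - (S.PhiL (S.coef (f.1, 0)), 0) := by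
    ext1
    · rfl
    · simp
  rw [e, map_sub, coef_PhiL, sub_self]

/-- The corrected operator preserves the P-coordinates, since its Q¹ part lands in ker π. Hence a C¹
row whose image is in ker π already lies in Q¹. -/
theorem rowOp_eq_of_coef_eq_zero {f : Fin c → PhaseSpace τ n × PhaseSpace τ n}
    (hf : ∀ j, f j ∈ C1 τ n)
    (h : ∀ j, S.coef ((S.rowOde f + S.rowCorrection (S.rowTrace f)) j) = 0) :
    (∀ j, f j ∈ S.Q1) ∧ S.rowOp f = S.rowOde f + S.rowCorrection (S.rowTrace f) := by
  have h0 : ∀ j, S.coef ((f j).1, 0) = 0 := fun j => by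
    have hj := h j
    rwa [rowOde_add_rowCorrection, Pi.add_apply, map_add,
      S.coef_rowOp _ (fun j => S.sub_PhiC_mem_Q1 (hf j)), coef_PhiL, zero_add] at hj
  refine ⟨fun j => S.mem_Q1_iff.2 ⟨hf j, h0 j⟩, ?_⟩
  have e1 : (fun j => f j - S.PhiC (S.coef ((f j).1, 0))) = f := by
    funext j
    rw [h0, map_zero, sub_zero]
  have e2 : (fun j => ((S.PhiL (S.coef ((f j).1, 0)), 0) : JumpSpace τ n)) = 0 := by
    funext j
    rw [h0, map_zero]
    rfl
  rw [rowOde_add_rowCorrection, e1, e2, add_zero]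

theorem exists_rowOde_eq (g : Fin c → JumpSpace τ n) :
    ∃ f ∈ Submodule.pi univ (fun _ : Fin c => C1 τ n), S.rowOde.toLinearMap f = g := by
  obtain ⟨φ, hφ, hφ0⟩ := exists_row_solution S.B (fun j => (g j).1) fun j => (g j).2
  refine ⟨fun j => (φ j, (∑ i, S.B i j • φ i) + (g j).1), fun j _ => hφ j, ?_⟩
  funext j
  refine (S.rowOde_apply _ j).trans ?_
  ext1
  · exact add_sub_cancel_left _ _
  · exact (sub_zero _).trans (hφ0 j)

/-- Fredholm alternative: the uncorrected operator is onto by solving an initial value problem, and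
the corrected one is injective on C¹ because its kernel lies in Q¹, where `rowOp_injective` applies.
So the corrected operator is onto, and preimages of ker π lie in Q¹. -/
theorem rowOp_surjective (g : Fin c → JumpSpace τ n) (hg : ∀ j, S.coef (g j) = 0) :
    ∃ f : Fin c → PhaseSpace τ n × PhaseSpace τ n, (∀ j, f j ∈ S.Q1) ∧ S.rowOp f = g := by
  obtain ⟨f, hf, hfg⟩ := LinearMap.surjOn_add_of_injOn _ S.rowOde.toLinearMap S.exists_rowOde_eq
    S.rowCorrection.toLinearMap S.rowTrace.toLinearMap (fun f hf h0 => by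
      have h0' : S.rowOde f + S.rowCorrection (S.rowTrace f) = 0 := h0
      obtain ⟨h1, h2⟩ := S.rowOp_eq_of_coef_eq_zero (fun j => hf j (mem_univ j))
        fun j => by rw [h0']; exact map_zero S.coef
      exact S.rowOp_injective f h1 (h2.trans h0')) g
  have hfg' : S.rowOde f + S.rowCorrection (S.rowTrace f) = g := hfg
  obtain ⟨h1, h2⟩ := S.rowOp_eq_of_coef_eq_zero (fun j => hf j (mem_univ j))
    fun j => by rw [hfg']; exact hg j
  exact ⟨f, h1, h2.trans hfg'⟩

end Splitting

/-! ### Implicit function theorems -/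

section ImplicitFunction

/-- Implicit function theorem: if `F(0,·)` is an invertible linear map, the solutions of
`F(x,y) = 0` near `0` are the graph of a smooth function. -/
theorem exists_implicit_of_linear {X Y Z : Type*} [NormedAddCommGroup X] [NormedSpace ℂ X]
    [CompleteSpace X] [NormedAddCommGroup Y] [NormedSpace ℂ Y] [CompleteSpace Y]
    [NormedAddCommGroup Z] [NormedSpace ℂ Z] {F : X × Y → Z} (hF : ContDiff ℂ ∞ F)
    (T : Y ≃L[ℂ] Z) (hT : ∀ y, F (0, y) = T y) :
    ∃ δ > 0, ∃ r > 0, ∃ H : X → Y, H 0 = 0 ∧ ContDiffOn ℂ ∞ H (Metric.ball 0 δ) ∧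
      ∀ x ∈ Metric.ball (0 : X) δ, F (x, H x) = 0 ∧ ‖H x‖ < r ∧
        ∀ y, ‖y‖ < 2 * r → F (x, y) = 0 → y = H x := by
  let G : X × Y → X × Z := fun q => (q.1, F q)
  have hG : ContDiff ℂ ∞ G := contDiff_fst.prodMk hF
  have hF0 : HasFDerivAt F (fderiv ℂ F 0) 0 := (hF.differentiable (by simp) 0).hasFDerivAt
  have hFT : fderiv ℂ F 0 ∘L ContinuousLinearMap.inr ℂ X Y = T := by
    have h1 : HasFDerivAt (fun y : Y => F (0, y))
        (fderiv ℂ F 0 ∘L ContinuousLinearMap.inr ℂ X Y) 0 :=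
      HasFDerivAt.comp (0 : Y) (g := F) (f := fun y => (0, y)) hF0
        (ContinuousLinearMap.inr ℂ X Y).hasFDerivAt
    rw [funext hT] at h1
    exact h1.unique T.hasFDerivAt
  let G' : (X × Y) ≃L[ℂ] (X × Z) := (ContinuousLinearEquiv.refl ℂ X).skewProd T
    (fderiv ℂ F 0 ∘L ContinuousLinearMap.inl ℂ X Y)
  have hG' : HasFDerivAt G (G' : X × Y →L[ℂ] X × Z) 0 := by
    have h1 : HasFDerivAt G ((ContinuousLinearMap.fst ℂ X Y).prod (fderiv ℂ F 0)) 0 :=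
      hasFDerivAt_fst.prodMk hF0
    convert h1 using 1
    refine ContinuousLinearMap.ext fun q => ?_
    have h2 : fderiv ℂ F 0 q = fderiv ℂ F 0 (q.1, 0) + fderiv ℂ F 0 (0, q.2) := by
      rw [← map_add]; simp
    have h3 : T q.2 = fderiv ℂ F 0 (0, q.2) := (DFunLike.congr_fun hFT q.2).symm
    simp [G', h2, h3, add_comm]
  have hn : (∞ : WithTop ℕ∞) ≠ 0 := by simp
  let e := hG.contDiffAt.toOpenPartialHomeomorph G hG' hn
  have heG : ∀ q, e q = G q := fun q => rfl
  have h0s : (0 : X × Y) ∈ e.source :=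
    ContDiffAt.mem_toOpenPartialHomeomorph_source hG.contDiffAt hG' hn
  have hG0 : e 0 = 0 := by
    rw [heG]; simp only [G, Prod.fst_zero]; rw [← Prod.mk_zero_zero, hT, map_zero]; rfl
  have h0t : (0 : X × Z) ∈ e.target := hG0 ▸ e.map_source h0s
  have hsymm0 : e.symm 0 = 0 := by rw [← hG0, e.left_inv h0s]
  have hfG : fderiv ℂ G 0 = G' := hG'.fderiv
  -- Invertibility of the derivative is open, and is needed at every point near 0 for the local
  -- inverse to be smooth on a whole ball.
  have hinv : {q | ∃ M : (X × Y) ≃L[ℂ] (X × Z), (M : X × Y →L[ℂ] X × Z) = fderiv ℂ G q}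
      ∈ 𝓝 (0 : X × Y) := by
    have h1 := G'.nhds
    rw [← hfG] at h1
    exact (hG.continuous_fderiv hn).continuousAt.preimage_mem_nhds h1
  obtain ⟨ρ, hρ, hball⟩ := Metric.mem_nhds_iff.1
    (Filter.inter_mem (e.open_source.mem_nhds h0s) hinv)
  have hc : ContinuousAt (fun x : X => e.symm (x, 0)) 0 := by
    refine ContinuousAt.comp (g := e.symm) ?_ (by fun_prop)
    exact e.continuousAt_symm h0t
  have hev : ∀ᶠ x in 𝓝 (0 : X), (x, (0 : Z)) ∈ e.target ∧ ‖e.symm (x, 0)‖ < ρ / 2 := by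
    refine Filter.Eventually.and ?_ ?_
    · have h1 : ContinuousAt (fun x : X => (x, (0 : Z))) 0 := by fun_prop
      exact h1.preimage_mem_nhds (e.open_target.mem_nhds h0t)
    · refine hc.norm.eventually_lt_const ?_
      change ‖e.symm 0‖ < _
      rw [hsymm0, norm_zero]
      positivity
  obtain ⟨δ, hδ, hδball⟩ := Metric.eventually_nhds_iff_ball.1 hev
  have hdef : ∀ x ∈ Metric.ball (0 : X) (min δ ρ), F (x, (e.symm (x, 0)).2) = 0 := fun x hx => by
    have h1 := e.right_inv (hδball x (Metric.ball_subset_ball (min_le_left _ _) hx)).1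
    rw [heG] at h1
    have h2 : (e.symm (x, 0)).1 = x := congrArg Prod.fst h1
    have h3 : F (e.symm (x, 0)) = 0 := congrArg Prod.snd h1
    rwa [← Prod.mk.eta (p := e.symm (x, 0)), h2] at h3
  -- With r = ρ/2 the solution stays in ‖y‖ < r while uniqueness holds in ‖y‖ < 2r. This gap is what
  -- later excludes a second branch by connectedness.
  refine ⟨min δ ρ, lt_min hδ hρ, ρ / 2, by positivity, fun x => (e.symm (x, 0)).2, ?_, ?_, ?_⟩
  · change (e.symm 0).2 = 0
    rw [hsymm0]; rfl
  · intro x hx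
    obtain ⟨hxt, hxn⟩ := hδball x (Metric.ball_subset_ball (min_le_left _ _) hx)
    have hmem : e.symm (x, 0) ∈ Metric.ball (0 : X × Y) ρ := by
      rw [mem_ball_zero_iff]; linarith
    obtain ⟨M, hM⟩ := (hball hmem).2
    have h1 : ContDiffAt ℂ ∞ e.symm (x, 0) := by
      refine e.contDiffAt_symm hxt (f₀' := M) ?_ hG.contDiffAt
      rw [hM]
      exact (hG.differentiable hn _).hasFDerivAt
    have h2 : ContDiffAt ℂ ∞ (fun x : X => e.symm (x, 0)) x :=
      h1.comp x (contDiff_id.prodMk contDiff_const).contDiffAt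
    exact h2.snd.contDiffWithinAt
  · intro x hx
    obtain ⟨hxt, hxn⟩ := hδball x (Metric.ball_subset_ball (min_le_left _ _) hx)
    refine ⟨hdef x hx, (norm_snd_le _).trans_lt hxn, fun y hy hxy => ?_⟩
    have hmem : (x, y) ∈ Metric.ball (0 : X × Y) ρ := by
      rw [mem_ball_zero_iff, Prod.norm_def, max_lt_iff]
      refine ⟨?_, by linarith⟩
      exact mem_ball_zero_iff.1 (Metric.ball_subset_ball (min_le_right _ _) hx)
    have h1 := e.left_inv (hball hmem).1
    have h2 : e (x, y) = (x, 0) := by rw [heG]; simp only [G, hxy]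
    rw [h2] at h1
    exact (congrArg Prod.snd h1).symm

/-- The implicit function theorem for a map that takes values in the kernel of an operator `κ`
with a right inverse. -/
theorem exists_implicit_of_linear_ker {X Y W K : Type*} [NormedAddCommGroup X] [NormedSpace ℂ X]
    [CompleteSpace X] [NormedAddCommGroup Y] [NormedSpace ℂ Y] [CompleteSpace Y]
    [NormedAddCommGroup W] [NormedSpace ℂ W] [CompleteSpace W] [NormedAddCommGroup K]
    [NormedSpace ℂ K] {F : X × Y → W} (hF : ContDiff ℂ ∞ F) (κ : W →L[ℂ] K) (P : K →L[ℂ] W)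
    (hP : ∀ k, κ (P k) = k) (hκ : ∀ q, κ (F q) = 0) (T : Y →L[ℂ] W) (hT : ∀ y, F (0, y) = T y)
    (hinj : ∀ y, T y = 0 → y = 0) (hsurj : ∀ w, κ w = 0 → ∃ y, T y = w) :
    ∃ δ > 0, ∃ r > 0, ∃ H : X → Y, H 0 = 0 ∧ ContDiffOn ℂ ∞ H (Metric.ball 0 δ) ∧
      ∀ x ∈ Metric.ball (0 : X) δ, F (x, H x) = 0 ∧ ‖H x‖ < r ∧
        ∀ y, ‖y‖ < 2 * r → F (x, y) = 0 → y = H x := by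
  let Z : Submodule ℂ W := LinearMap.ker κ.toLinearMap
  have hZ : IsClosed (Z : Set W) := isClosed_eq κ.continuous continuous_const
  have : CompleteSpace Z := hZ.completeSpace_coe
  -- 1 − Pκ projects W onto ker κ, a complete space, and fixes all values of F, so the previous
  -- theorem applies with target ker κ.
  let ρ : W →L[ℂ] Z := (ContinuousLinearMap.id ℂ W - P ∘L κ).codRestrict Z fun w => by
    change κ (w - P (κ w)) = 0
    rw [map_sub, hP, sub_self]
  have hρ : ∀ w, κ w = 0 → (ρ w : W) = w := fun w hw => by
    change w - P (κ w) = w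
    rw [hw, map_zero, sub_zero]
  have hρF : ∀ q, (ρ (F q) : W) = F q := fun q => hρ _ (hκ q)
  have hρT : ∀ y, (ρ (T y) : W) = T y := fun y => by rw [← hT]; exact hρF _
  let e : Y ≃L[ℂ] Z := ContinuousLinearEquiv.ofBijective (ρ ∘L T)
    ((LinearMap.ker_eq_bot').2 fun y hy => hinj y (by
      rw [← hρT]; exact congrArg Subtype.val hy))
    (LinearMap.range_eq_top.2 fun z => by
      obtain ⟨y, hy⟩ := hsurj z z.2
      exact ⟨y, Subtype.ext ((hρT y).trans hy)⟩)
  obtain ⟨δ, hδ, r, hr, H, H0, hH, hsol⟩ := exists_implicit_of_linear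
    (F := fun q => ρ (F q)) (ρ.contDiff.comp hF) e (fun y => by rw [hT]; rfl)
  have hiff : ∀ q, ρ (F q) = 0 ↔ F q = 0 := fun q =>
    ⟨fun h => by rw [← hρF q, h]; rfl, fun h => by rw [h, map_zero]⟩
  refine ⟨δ, hδ, r, hr, H, H0, hH, fun x hx => ?_⟩
  obtain ⟨h1, h2, h3⟩ := hsol x hx
  exact ⟨(hiff _).1 h1, h2, fun y hy h0 => h3 y hy ((hiff _).2 h0)⟩

/-- The expression is polynomial in (ℓ, h), being built from continuous linear maps, evaluation of ℓ
and products. -/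
theorem contDiff_row_operator {E M Q W : Type*} [NormedAddCommGroup E] [NormedSpace ℂ E]
    [NormedAddCommGroup M] [NormedSpace ℂ M] [NormedAddCommGroup Q] [NormedSpace ℂ Q]
    [NormedAddCommGroup W] [NormedSpace ℂ W] {c : ℕ} (D : Q →L[ℂ] W) (J : M →L[ℂ] W)
    (f : Q →L[ℂ] E) (I : E →L[ℂ] W) (Φ : Fin c → E) (B : Matrix (Fin c) (Fin c) ℂ)
    (ψ : Fin c → M →L[ℂ] ℂ) :
    ContDiff ℂ ∞ fun (q : (E →L[ℂ] M) × (Fin c → Q)) (j : Fin c) =>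
      D (q.2 j) + J (q.1 (f (q.2 j))) + J (q.1 (Φ j))
        - I (∑ i, (B i j + ψ i (q.1 (Φ j + f (q.2 j)))) • f (q.2 i)) := by
  refine contDiff_pi.2 fun j => ?_
  fun_prop

end ImplicitFunction

/-! ### Existence and uniqueness of h(α) -/

namespace Splitting

variable {τ : ℝ} [hτ : Fact (0 < τ)] {n c p : ℕ} (S : Splitting τ n c)

/-- `(I - π) X₀` as a continuous linear map. -/
noncomputable def jumpL : (Fin n → ℂ) →L[ℂ] JumpSpace τ n :=
  ContinuousLinearMap.inr ℂ _ _ -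
    ContinuousLinearMap.inl ℂ _ _ ∘L S.PhiL ∘L S.coef ∘L ContinuousLinearMap.inr ℂ _ _

theorem jumpL_apply (μ : Fin n → ℂ) : S.jumpL μ = S.jump μ := by
  rw [jump, proj_eq]; rfl

/-- The inclusion of `Q¹` into `C_n`. -/
noncomputable def fnL : S.Q1 →L[ℂ] PhaseSpace τ n :=
  ContinuousLinearMap.fst ℂ _ _ ∘L S.Q1.subtypeL

/-- The operator `N` as a function of `ℓ = L(α) - L₀` and `h`. -/
noncomputable def NOp (ℓ : PhaseSpace τ n →L[ℂ] (Fin n → ℂ)) (h : Fin c → S.Q1) :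
    Fin c → JumpSpace τ n := fun j =>
  S.AQ (h j) + S.jump (ℓ (S.fn (h j))) + S.jump (ℓ (S.Phi j))
    - (∑ i, (S.B + S.Psi0 * Matrix.of fun k j => ℓ (S.Phi j + S.fn (h j)) k) i j • S.fn (h i), 0)

theorem N_eq_NOp (L : (Fin p → ℂ) → PhaseSpace τ n →L[ℂ] (Fin n → ℂ)) (α : Fin p → ℂ)
    (h : Fin c → S.Q1) : S.N L α h = S.NOp (L α - S.L₀) h := rfl

theorem coef_NOp (ℓ : PhaseSpace τ n →L[ℂ] (Fin n → ℂ)) (h : Fin c → S.Q1) (j : Fin c) :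
    S.coef (S.NOp ℓ h j) = 0 := by
  have := S.coef_N (p := 0) (fun _ => ℓ + S.L₀) 0 h j
  rwa [N_eq_NOp, add_sub_cancel_right ℓ S.L₀] at this

theorem NOp_zero (h : Fin c → S.Q1) : S.NOp 0 h = S.rowOp fun j => (h j).1 := by
  funext j
  have h1 : S.jump 0 = 0 := by rw [← jumpL_apply, map_zero]
  have h2 : (Matrix.of fun (k : Fin n) (j : Fin c) =>
      (0 : PhaseSpace τ n →L[ℂ] (Fin n → ℂ)) (S.Phi j + S.fn (h j)) k) = 0 := rfl
  rw [NOp, rowOp_apply, h2]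
  simp only [zero_apply, h1, add_zero, Matrix.mul_zero]
  rfl

/-- The row `i` of `Ψ(0)` as a functional. -/
noncomputable def psiL (i : Fin c) : (Fin n → ℂ) →L[ℂ] ℂ :=
  ContinuousLinearMap.proj i ∘L LinearMap.toContinuousLinearMap S.Psi0.mulVecLin

theorem NOp_apply (ℓ : PhaseSpace τ n →L[ℂ] (Fin n → ℂ)) (h : Fin c → S.Q1) (j : Fin c) :
    S.NOp ℓ h j = (S.dL ∘L S.Q1.subtypeL) (h j) + S.jumpL (ℓ (S.fnL (h j)))
      + S.jumpL (ℓ (S.Phi j)) - ContinuousLinearMap.inl ℂ (PhaseSpace τ n) (Fin n → ℂ)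
        (∑ i, (S.B i j + S.psiL i (ℓ (S.Phi j + S.fnL (h j)))) • S.fnL (h i)) := by
  rw [jumpL_apply, jumpL_apply]
  rfl

theorem contDiff_NOp : ContDiff ℂ ∞
    fun q : (PhaseSpace τ n →L[ℂ] (Fin n → ℂ)) × (Fin c → S.Q1) => S.NOp q.1 q.2 := by
  have h := contDiff_row_operator (E := PhaseSpace τ n) (M := Fin n → ℂ) (Q := S.Q1)
    (W := JumpSpace τ n) (S.dL ∘L S.Q1.subtypeL) S.jumpL S.fnL
    (ContinuousLinearMap.inl ℂ (PhaseSpace τ n) (Fin n → ℂ)) S.Phi S.B S.psiL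
  have e : (fun q : (PhaseSpace τ n →L[ℂ] (Fin n → ℂ)) × (Fin c → S.Q1) => S.NOp q.1 q.2) = _ :=
    funext fun q => funext fun j => S.NOp_apply q.1 q.2 j
  rw [e]
  exact h

/-- The linear operator `h ↦ A_{Q¹} h - h B` from `(Q¹)^c` to `(BC_n)^c`. -/
noncomputable def homologicalMap : (Fin c → S.Q1) →L[ℂ] (Fin c → JumpSpace τ n) :=
  S.rowOp ∘L ContinuousLinearMap.pi fun j => S.Q1.subtypeL ∘L ContinuousLinearMap.proj j

theorem homologicalMap_injective (h : Fin c → S.Q1) (h0 : S.homologicalMap h = 0) : h = 0 := by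
  have h2 := S.rowOp_injective _ (fun j => (h j).2) h0
  funext j
  exact Subtype.ext (congrFun h2 j)

/-- The parameter is the operator ℓ, in which N is complex smooth; no assumption on the dependence
of L on α enters yet. -/
theorem exists_solution_NOp : ∃ δ > 0, ∃ r > 0,
    ∃ H : (PhaseSpace τ n →L[ℂ] (Fin n → ℂ)) → Fin c → S.Q1,
      H 0 = 0 ∧ ContDiffOn ℂ ∞ H (Metric.ball 0 δ) ∧
      ∀ ℓ ∈ Metric.ball (0 : PhaseSpace τ n →L[ℂ] (Fin n → ℂ)) δ,
        S.NOp ℓ (H ℓ) = 0 ∧ ‖H ℓ‖ < r ∧ ∀ h, ‖h‖ < 2 * r → S.NOp ℓ h = 0 → h = H ℓ := by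
  let κ : (Fin c → JumpSpace τ n) →L[ℂ] (Fin c → Fin c → ℂ) :=
    ContinuousLinearMap.pi fun j => S.coef ∘L ContinuousLinearMap.proj j
  let P : (Fin c → Fin c → ℂ) →L[ℂ] (Fin c → JumpSpace τ n) :=
    ContinuousLinearMap.pi fun j => ContinuousLinearMap.inl ℂ _ _ ∘L S.PhiL ∘L
      ContinuousLinearMap.proj j
  exact exists_implicit_of_linear_ker S.contDiff_NOp κ P
    (fun k => funext fun j => S.coef_PhiL (k j)) (fun q => funext fun j => S.coef_NOp q.1 q.2 j)
    S.homologicalMap S.NOp_zero S.homologicalMap_injective (fun w hw => by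
      obtain ⟨f, hf, hfw⟩ := S.rowOp_surjective w fun j => congrFun hw j
      exact ⟨fun j => ⟨f j, hf j⟩, hfw⟩)

variable (L : (Fin p → ℂ) → PhaseSpace τ n →L[ℂ] (Fin n → ℂ))

/-- Compose the solution H with α ↦ L(α) − L₀. The local uniqueness of H holds only for small rows,
and connectedness of U extends it to every continuous branch through 0. -/
theorem exists_unique_solution_N (hL : ContDiff ℝ ∞ L) (hL0 : L 0 = S.L₀) :
    ∃ V : Set (Fin p → ℂ), IsOpen V ∧ IsConnected V ∧ 0 ∈ V ∧
      ∃ h : (Fin p → ℂ) → Fin c → S.Q1,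
        ContDiffOn ℝ ∞ h V ∧ (ContDiff ℂ ∞ L → ContDiffOn ℂ ∞ h V) ∧
        h 0 = 0 ∧ (∀ α ∈ V, S.N L α (h α) = 0) ∧
        ∀ U ⊆ V, IsOpen U → IsConnected U → 0 ∈ U →
          ∀ k : (Fin p → ℂ) → Fin c → S.Q1, ContDiffOn ℝ ∞ k U → k 0 = 0 →
            (∀ α ∈ U, S.N L α (k α) = 0) → EqOn k h U := by
  obtain ⟨δ, hδ, r, hr, H, H0, hH, hsol⟩ := S.exists_solution_NOp
  have hc : ContinuousAt (fun α => L α - S.L₀) 0 :=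
    (hL.sub contDiff_const).continuous.continuousAt
  have hL00 : L 0 - S.L₀ = 0 := by rw [hL0, sub_self S.L₀]
  have hpre : (fun α => L α - S.L₀) ⁻¹' Metric.ball 0 δ ∈ 𝓝 (0 : Fin p → ℂ) := by
    refine hc.preimage_mem_nhds ?_
    rw [hL00]
    exact Metric.ball_mem_nhds (0 : PhaseSpace τ n →L[ℂ] (Fin n → ℂ)) hδ
  obtain ⟨ε, hε, hball⟩ := Metric.mem_nhds_iff.1 hpre
  have hsol' : ∀ α ∈ Metric.ball (0 : Fin p → ℂ) ε, _ := fun α hα => hsol _ (hball hα)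
  have hreal : ContDiffOn ℝ ∞ (fun α => H (L α - S.L₀)) (Metric.ball 0 ε) :=
    (hH.restrict_scalars ℝ).comp (hL.sub contDiff_const).contDiffOn hball
  refine ⟨Metric.ball 0 ε, Metric.isOpen_ball, ?_, Metric.mem_ball_self hε,
    fun α => H (L α - S.L₀), hreal, fun hLC =>
      hH.comp (hLC.sub contDiff_const).contDiffOn hball, ?_, fun α hα => (hsol' α hα).1, ?_⟩
  · exact ⟨⟨0, Metric.mem_ball_self hε⟩, (convex_ball (0 : Fin p → ℂ) ε).isPreconnected⟩
  · change H (L 0 - S.L₀) = 0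
    rw [hL00, H0]
  · intro U hUV hU hUc h0U k hk hk0 hkN
    have hkey : ∀ α ∈ U, ‖k α‖ < 2 * r → k α = H (L α - S.L₀) := fun α hα hα' =>
      (hsol' α (hUV hα)).2.2 _ hα' (hkN α hα)
    have hkc : ContinuousOn (fun α => ‖k α‖) U := hk.continuousOn.norm
    by_contra hne
    have hne' : ∃ α ∈ U, r < ‖k α‖ := by
      by_contra! hcon
      exact hne fun α hα => hkey α hα (by linarith [hcon α hα])
    obtain ⟨β, hβ, hβr⟩ := hne'
    -- A branch that leaves the ball of radius r passes through norm exactly r. There it is below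
    -- 2r, so it equals H, whose norm is below r: a contradiction.
    obtain ⟨α, hα, hαr⟩ := hUc.isPreconnected.intermediate_value h0U hβ hkc
      (show r ∈ Icc ‖k 0‖ ‖k β‖ from ⟨by
        rw [hk0]; exact (norm_zero (E := Fin c → S.Q1)).le.trans hr.le, hβr.le⟩)
    have h1 := hkey α hα (by simp only at hαr; linarith)
    have h2 := (hsol' α (hUV hα)).2.1
    simp only at hαr
    rw [← h1, hαr] at h2
    exact lt_irrefl _ h2

end Splitting

/-! ### Graphs as submanifolds -/

section Submanifold

/-- The graph of a smooth function over an open set is an embedded submanifold. -/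
theorem isSmoothSubmanifold_graph {𝕜 X Y : Type*} [NontriviallyNormedField 𝕜]
    [NormedAddCommGroup X] [NormedSpace 𝕜 X] [FiniteDimensional 𝕜 X] [NormedAddCommGroup Y]
    [NormedSpace 𝕜 Y] {U : Set X} (hU : IsOpen U) {g : X → Y} (hg : ContDiffOn 𝕜 ∞ g U) :
    IsSmoothSubmanifold 𝕜 (Module.finrank 𝕜 X) {s : X × Y | s.1 ∈ U ∧ s.2 = g s.1} := by
  have hsrc : IsOpen {s : X × Y | s.1 ∈ U} := hU.preimage continuous_fst
  have hg' : ContDiffOn 𝕜 ∞ (fun s : X × Y => g s.1) {s : X × Y | s.1 ∈ U} :=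
    hg.comp contDiffOn_fst fun s hs => hs
  have hto : ContDiffOn 𝕜 ∞ (fun s : X × Y => (s.1, s.2 - g s.1)) {s : X × Y | s.1 ∈ U} :=
    contDiffOn_fst.prodMk (contDiffOn_snd.sub hg')
  have hinv : ContDiffOn 𝕜 ∞ (fun s : X × Y => (s.1, s.2 + g s.1)) {s : X × Y | s.1 ∈ U} :=
    contDiffOn_fst.prodMk (contDiffOn_snd.add hg')
  -- The shear subtracting g flattens the graph to X × {0}, with one chart serving all points.
  let e : OpenPartialHomeomorph (X × Y) (X × Y) :=
    { toFun := fun s => (s.1, s.2 - g s.1)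
      invFun := fun s => (s.1, s.2 + g s.1)
      source := {s | s.1 ∈ U}
      target := {s | s.1 ∈ U}
      map_source' := fun s hs => hs
      map_target' := fun s hs => hs
      left_inv' := fun s _ => by simp
      right_inv' := fun s _ => by simp
      open_source := hsrc
      open_target := hsrc
      continuousOn_toFun := hto.continuousOn
      continuousOn_invFun := hinv.continuousOn }
  intro q hq
  refine ⟨e, hq.1, hto, hinv, LinearMap.range (LinearMap.inl 𝕜 X Y), inferInstance,
    LinearMap.finrank_range_of_inj LinearMap.inl_injective, fun s hs => ?_⟩
  change (s.1 ∈ U ∧ s.2 = g s.1) ↔ (s.1, s.2 - g s.1) ∈ LinearMap.range (LinearMap.inl 𝕜 X Y)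
  rw [LinearMap.mem_range]
  constructor
  · rintro ⟨-, h⟩
    exact ⟨s.1, by simp [h]⟩
  · rintro ⟨x, hx⟩
    exact ⟨hs, (sub_eq_zero.1 (congrArg Prod.snd hx).symm)⟩

theorem contDiff_sum_smul {Q : Type*} [NormedAddCommGroup Q] [NormedSpace ℂ Q] {c : ℕ} :
    ContDiff ℂ ∞ fun q : (Fin c → Q) × (Fin c → ℂ) => ∑ j, q.2 j • q.1 j := by
  fun_prop

end Submanifold

/-! ### Uniqueness for the transport equation -/

section Uniqueness

variable {τ : ℝ} [hτ : Fact (0 < τ)] {n : ℕ}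

theorem eq_of_hasDerivWithinAt_zero {E : Type*} [NormedAddCommGroup E] [NormedSpace ℝ E]
    {f : ℝ → E} {T : ℝ} (hf : ∀ t ∈ Ico 0 T, HasDerivWithinAt f 0 (Ico 0 T) t) {t : ℝ}
    (ht : t ∈ Ico 0 T) : f t = f 0 := by
  have hsub : Icc 0 t ⊆ Ico 0 T := fun s hs => ⟨hs.1, hs.2.trans_lt ht.2⟩
  exact constant_of_has_deriv_right_zero
    (fun s hs => ((hf s (hsub hs)).continuousWithinAt).mono hsub)
    (fun s hs => ((hf s (hsub (Ico_subset_Icc_self hs))).mono hsub).mono_of_mem_nhdsWithin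
      (Icc_mem_nhdsGE_of_mem hs)) t (right_mem_Icc.2 ht.1)

/-- Solutions of `∂ₜ u = ∂_θ u` whose boundary value at `θ = 0` satisfies
`|∂_θ u(t,0)| ≤ K ‖u(t)‖` are determined by `u(0)`. -/
theorem eq_zero_of_transport {u v : ℝ → PhaseSpace τ n} {T K : ℝ} (hK : 0 ≤ K)
    (hu : ∀ t ∈ Ico 0 T, HasDerivWithinAt u (v t) (Ico 0 T) t)
    (hC : ∀ t ∈ Ico 0 T, (u t, v t) ∈ C1 τ n)
    (hb : ∀ t ∈ Ico 0 T, ‖extC (v t) 0‖ ≤ K * ‖u t‖) (h0 : u 0 = 0) {t : ℝ}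
    (ht : t ∈ Ico 0 T) : u t = 0 := by
  have hsub : Icc 0 t ⊆ Ico 0 T := fun s hs => ⟨hs.1, hs.2.trans_lt ht.2⟩
  have hu' : ∀ s ∈ Icc 0 t, HasDerivWithinAt u (v s) (Icc 0 t) s := fun s hs =>
    (hu s (hsub hs)).mono hsub
  have hcu : ContinuousOn u (Icc 0 t) := fun s hs => (hu' s hs).continuousWithinAt
  -- The weight e^{−as} is chosen so that (K+1)M e^{as} is the derivative of (M/2)e^{as}.
  -- Integrating the boundary condition then halves the weighted maximum M, which forces M = 0.
  set a : ℝ := 2 * (K + 1) with ha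
  obtain ⟨r, hr, hmax⟩ := isCompact_Icc.exists_isMaxOn (nonempty_Icc.2 ht.1)
    (f := fun s => Real.exp (-(a * s)) * ‖u s‖)
    (ContinuousOn.mul (Continuous.continuousOn (by fun_prop)) hcu.norm)
  set M := Real.exp (-(a * r)) * ‖u r‖ with hM
  have hM0 : 0 ≤ M := by positivity
  have hle : ∀ s ∈ Icc 0 t, ‖u s‖ ≤ M * Real.exp (a * s) := fun s hs => by
    have h1 : Real.exp (-(a * s)) * ‖u s‖ ≤ M := hmax hs
    rw [Real.exp_neg, inv_mul_le_iff₀ (Real.exp_pos _)] at h1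
    linarith
  have hz : ∀ s ∈ Icc 0 t, ‖extC (u s) 0‖ ≤ M / 2 * Real.exp (a * s) := by
    have hdz : ∀ s ∈ Icc 0 t, HasDerivWithinAt (fun s => extC (u s) 0) (extC (v s) 0)
        (Icc 0 t) s := fun s hs =>
      ((evalC (n := n) (τ := τ) 0).restrictScalars ℝ).hasFDerivAt.comp_hasDerivWithinAt s
        (hu' s hs)
    refine fun s hs => image_norm_le_of_norm_deriv_right_le_deriv_boundary
      (f := fun s => extC (u s) 0) (f' := fun s => extC (v s) 0)
      (B := fun s => M / 2 * Real.exp (a * s)) (B' := fun s => M / 2 * (Real.exp (a * s) * a))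
      (fun s hs => (hdz s hs).continuousWithinAt)
      (fun s hs => (hdz s (Ico_subset_Icc_self hs)).mono_of_mem_nhdsWithin
        (Icc_mem_nhdsGE_of_mem hs)) ?_ (fun s => ?_) (fun s hs => ?_) hs
    · rw [h0, extC_zero, norm_zero]
      positivity
    · have h1 : HasDerivAt (fun s : ℝ => a * s) a s := by
        simpa using (hasDerivAt_id s).const_mul a
      exact (h1.exp).const_mul _
    · have hs' := Ico_subset_Icc_self hs
      have h1 := hle s hs'
      calc ‖extC (v s) 0‖ ≤ K * ‖u s‖ := hb s (hsub hs')
        _ ≤ (K + 1) * (M * Real.exp (a * s)) := by gcongr; linarith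
        _ = M / 2 * (Real.exp (a * s) * a) := by rw [ha]; ring
  have hur : ‖u r‖ ≤ M / 2 * Real.exp (a * r) := by
    refine (ContinuousMap.norm_le _ (by positivity)).2 fun θ => ?_
    rw [← extC_coe]
    have hθ1 := θ.2.1
    have hθ2 := θ.2.2
    -- The value u(r)(θ) is carried along its characteristic either from the boundary θ = 0 at time
    -- r+θ, or from the zero initial function if r+θ ≤ 0.
    rcases le_total 0 (r + θ) with h | h
    · have hsub' : Icc (r + θ) r ⊆ Ico 0 T := fun s hs =>
        hsub ⟨h.trans hs.1, hs.2.trans hr.2⟩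
      have h1 := extC_eq_of_characteristic (u := u) (v := v) (r := r + θ) (t := r) (a := r + θ)
        (by linarith) (fun s hs => (hu s (hsub' hs)).mono hsub') (fun s hs => hC s (hsub' hs))
        (fun s hs => ⟨by linarith [hs.2], by linarith [hs.1]⟩)
      rw [add_sub_cancel_left, sub_self] at h1
      rw [h1]
      refine (hz (r + θ) ⟨h, by linarith [hr.2]⟩).trans ?_
      have : a * (r + θ) ≤ a * r := mul_le_mul_of_nonneg_left (by linarith) (by positivity)
      gcongr
    · have hsub' : Icc 0 r ⊆ Ico 0 T := fun s hs => hsub ⟨hs.1, hs.2.trans hr.2⟩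
      have h1 := extC_eq_of_characteristic (u := u) (v := v) (r := 0) (t := r) (a := r + θ)
        hr.1 (fun s hs => (hu s (hsub' hs)).mono hsub') (fun s hs => hC s (hsub' hs))
        (fun s hs => ⟨by linarith [hs.2], by linarith [hs.1]⟩)
      rw [add_sub_cancel_left] at h1
      rw [h1, h0, extC_zero, norm_zero]
      positivity
  have hMle : M ≤ M / 2 := by
    have h1 : Real.exp (-(a * r)) * ‖u r‖ ≤ Real.exp (-(a * r)) * (M / 2 * Real.exp (a * r)) := by
      gcongr
    calc M ≤ _ := h1
      _ = M / 2 * (Real.exp (-(a * r)) * Real.exp (a * r)) := by ring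
      _ = M / 2 := by rw [← Real.exp_add, neg_add_cancel, Real.exp_zero, mul_one]
  have hMz : M = 0 := by linarith
  have h1 := hle t (right_mem_Icc.2 ht.1)
  rw [hMz, zero_mul] at h1
  exact norm_le_zero_iff.1 h1

end Uniqueness

/-! ### Smoothness and dimension of W -/

namespace Splitting

variable {τ : ℝ} [hτ : Fact (0 < τ)] {n c p : ℕ} (S : Splitting τ n c)
  (L : (Fin p → ℂ) → PhaseSpace τ n →L[ℂ] (Fin n → ℂ))

theorem contDiff_rowMul :
    ContDiff ℂ ∞ fun q : (Fin c → S.Q1) × (Fin c → ℂ) => S.rowMul q.1 q.2 :=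
  contDiff_sum_smul (Q := S.Q1)

theorem W_eq_graph (V : Set (Fin p → ℂ)) (h : (Fin p → ℂ) → Fin c → S.Q1) :
    S.W V h = {s : S.State p | s.1 ∈ Prod.snd ⁻¹' V ∧
      s.2 = (fun q : (Fin c → ℂ) × (Fin p → ℂ) => (S.rowMul (h q.2) q.1, (0 : R1 τ p))) s.1} := by
  ext s
  exact and_congr_right fun _ =>
    ⟨fun h => Prod.ext h.1 h.2, fun h => ⟨congrArg Prod.fst h, congrArg Prod.snd h⟩⟩

theorem finrank_center :
    Module.finrank ℂ ((Fin c → ℂ) × (Fin p → ℂ)) = c + p := by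
  rw [Module.finrank_prod, Module.finrank_fin_fun, Module.finrank_fin_fun]

theorem isSmoothSubmanifold_W_complex {V : Set (Fin p → ℂ)} (hV : IsOpen V)
    {h : (Fin p → ℂ) → Fin c → S.Q1} (hh : ContDiffOn ℂ ∞ h V) :
    IsSmoothSubmanifold ℂ (c + p) (S.W V h) := by
  rw [W_eq_graph, ← finrank_center (c := c) (p := p)]
  have hg : ContDiffOn ℂ ∞ (fun q : (Fin c → ℂ) × (Fin p → ℂ) => S.rowMul (h q.2) q.1)
      (Prod.snd ⁻¹' V) :=
    S.contDiff_rowMul.comp_contDiffOn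
      ((hh.comp contDiffOn_snd fun q hq => hq).prodMk contDiffOn_fst)
  exact isSmoothSubmanifold_graph (𝕜 := ℂ) (X := (Fin c → ℂ) × (Fin p → ℂ))
    (Y := S.Q1 × R1 τ p) (g := fun q => (S.rowMul (h q.2) q.1, 0)) (hV.preimage continuous_snd)
    (hg.prodMk contDiffOn_const)

theorem isSmoothSubmanifold_W_real {V : Set (Fin p → ℂ)} (hV : IsOpen V)
    {h : (Fin p → ℂ) → Fin c → S.Q1} (hh : ContDiffOn ℝ ∞ h V) :
    IsSmoothSubmanifold ℝ (2 * (c + p)) (S.W V h) := by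
  rw [W_eq_graph, ← finrank_center (c := c) (p := p), ← finrank_real_of_complex]
  have hg : ContDiffOn ℝ ∞ (fun q : (Fin c → ℂ) × (Fin p → ℂ) => S.rowMul (h q.2) q.1)
      (Prod.snd ⁻¹' V) :=
    (S.contDiff_rowMul.restrict_scalars ℝ).comp_contDiffOn
      ((hh.comp contDiffOn_snd fun q hq => hq).prodMk contDiffOn_fst)
  exact isSmoothSubmanifold_graph (𝕜 := ℝ) (X := (Fin c → ℂ) × (Fin p → ℂ))
    (Y := S.Q1 × R1 τ p) (g := fun q => (S.rowMul (h q.2) q.1, 0)) (hV.preimage continuous_snd)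
    (hg.prodMk contDiffOn_const)

end Splitting

/-! ### Invariance of W and the reduced dynamics -/

section RowLinear

variable {E F M Q W : Type*} [NormedAddCommGroup E] [NormedSpace ℂ E] [NormedAddCommGroup F]
  [NormedSpace ℂ F] [NormedAddCommGroup M] [NormedSpace ℂ M] [NormedAddCommGroup Q]
  [NormedSpace ℂ Q] [NormedAddCommGroup W] [NormedSpace ℂ W] {n c : ℕ}

theorem ContinuousLinearMap.map_sum_smul (f : E →L[ℂ] F) (v : Fin c → E) (x : Fin c → ℂ) :
    f (∑ j, x j • v j) = ∑ j, x j • f (v j) := by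
  simp only [map_sum, map_smul]

theorem ContinuousLinearMap.map_sum_smul_add (f : E →L[ℂ] (Fin n → ℂ)) (a b : Fin c → E)
    (x : Fin c → ℂ) : f (∑ j, x j • a j + ∑ j, x j • b j)
      = (Matrix.of fun k j => f (a j + b j) k) *ᵥ x := by
  rw [← Finset.sum_add_distrib]
  simp only [← smul_add, map_sum, map_smul]
  ext k
  simp only [Matrix.mulVec, dotProduct, Matrix.of_apply, Finset.sum_apply, Pi.smul_apply,
    smul_eq_mul, mul_comm]

/-- With the matrix fixed, the row equation is linear in each column, so weighting the columns by x
and summing gives the equation for h x. -/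
theorem row_operator_sum_smul (D : Q →L[ℂ] W) (J : M →L[ℂ] W) (ℓ : E →L[ℂ] M) (f : Q →L[ℂ] E)
    (I : E →L[ℂ] W) (Φ : Fin c → E) (B : Matrix (Fin c) (Fin c) ℂ) (h : Fin c → Q)
    (hj : ∀ j, D (h j) + J (ℓ (f (h j))) + J (ℓ (Φ j)) = I (∑ i, B i j • f (h i)))
    (x : Fin c → ℂ) :
    D (∑ j, x j • h j) + J (ℓ (∑ j, x j • Φ j + f (∑ j, x j • h j)))
      = I (∑ j, x j • ∑ i, B i j • f (h i)) := by
  rw [I.map_sum_smul]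
  simp only [← hj, map_add, map_sum, map_smul, smul_add, Finset.sum_add_distrib]
  abel

end RowLinear

/-- A component of a solution with values in `C_n ⊂ BC_n` has a derivative without jump part. -/
theorem hasDerivWithinAt_inl {τ : ℝ} {m : ℕ} {f : ℝ → PhaseSpace τ m} {g : JumpSpace τ m} {T t : ℝ}
    (ht : t ∈ Ico 0 T)
    (hf : HasDerivWithinAt (fun s => ((f s, 0) : JumpSpace τ m)) g (Ico 0 T) t) :
    HasDerivWithinAt f g.1 (Ico 0 T) t ∧ g.2 = 0 := by
  have h1 := ((ContinuousLinearMap.fst ℝ (PhaseSpace τ m) (Fin m → ℂ)).hasFDerivAt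
    ).comp_hasDerivWithinAt t hf
  have h2 := ((ContinuousLinearMap.snd ℝ (PhaseSpace τ m) (Fin m → ℂ)).hasFDerivAt
    ).comp_hasDerivWithinAt t hf
  exact ⟨h1, (uniqueDiffOn_Ico 0 T t ht).eq_deriv _ h2 (hasDerivWithinAt_const t _ 0)⟩

namespace Splitting

variable {τ : ℝ} [hτ : Fact (0 < τ)] {n c p : ℕ} (S : Splitting τ n c)
  (L : (Fin p → ℂ) → PhaseSpace τ n →L[ℂ] (Fin n → ℂ))

theorem fn_rowMul (h : Fin c → S.Q1) (x : Fin c → ℂ) :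
    S.fn (S.rowMul h x) = rowC (fun j => S.fn (h j)) x := by
  rw [rowC_apply]
  exact ContinuousLinearMap.map_sum_smul (E := S.Q1) (F := PhaseSpace τ n) S.fnL h x

theorem Q1_ext {y y' : S.Q1} (h : S.fn y = S.fn y') : y = y' :=
  Subtype.ext (C1_ext y.2.1 y'.2.1 h)

/-- Separates the jump μ from the continuous part −ΦΨ(0)μ, the term that cancels against the forcing
of ẋ when Φx + y is formed. -/
theorem jump_eq (μ : Fin n → ℂ) : S.jump μ = (-S.PhiL (S.Psi0 *ᵥ μ), μ) := by
  have h : S.coef (0, μ) = S.Psi0 *ᵥ μ := by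
    ext i
    rw [coef_apply, map_zero, zero_add]
  rw [jump, proj_eq, h]
  ext1
  · exact zero_sub _
  · exact sub_zero _

theorem reducedMatrix_mulVec (α : Fin p → ℂ) (h : Fin c → S.Q1) (x : Fin c → ℂ) :
    S.B *ᵥ x + S.Psi0 *ᵥ ((L α - S.L₀) (S.PhiMul x + S.fn (S.rowMul h x)))
      = S.reducedMatrix L α h *ᵥ x := by
  have e : (L α - S.L₀) (S.PhiMul x + S.fn (S.rowMul h x))
      = (Matrix.of fun k j => (L α - S.L₀) (S.Phi j + S.fn (h j)) k) *ᵥ x := by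
    rw [fn_rowMul, rowC_apply]
    exact ContinuousLinearMap.map_sum_smul_add (E := PhaseSpace τ n) (L α - S.L₀) S.Phi
      (fun j => S.fn (h j)) x
  rw [reducedMatrix, Matrix.add_mulVec, ← Matrix.mulVec_mulVec, e]

/-- The invariance equation: `N(α,h) = 0` says that `y = h x` solves the second equation of the
projected system when `ẋ = ℬ(α) x`. -/
theorem AQ_add_jump_rowMul {α : Fin p → ℂ} {h : Fin c → S.Q1} (hN : S.N L α h = 0)
    (x : Fin c → ℂ) :
    S.AQ (S.rowMul h x) + S.jump ((L α - S.L₀) (S.PhiMul x + S.fn (S.rowMul h x)))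
      = (rowC (fun j => S.fn (h j)) (S.reducedMatrix L α h *ᵥ x), 0) := by
  have hj : ∀ j, (S.dL ∘L S.Q1.subtypeL) (h j) + S.jumpL ((L α - S.L₀) (S.fnL (h j)))
      + S.jumpL ((L α - S.L₀) (S.Phi j))
      = ContinuousLinearMap.inl ℂ (PhaseSpace τ n) (Fin n → ℂ)
        (∑ i, S.reducedMatrix L α h i j • S.fnL (h i)) := fun j => by
    have := congrFun hN j
    rw [N_eq_NOp, NOp_apply] at this
    exact sub_eq_zero.1 this
  rw [← jumpL_apply, rowC_mulVec]
  have key := row_operator_sum_smul (E := PhaseSpace τ n) (M := Fin n → ℂ) (Q := S.Q1)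
    (W := JumpSpace τ n) (S.dL ∘L S.Q1.subtypeL) S.jumpL (L α - S.L₀) S.fnL
    (ContinuousLinearMap.inl ℂ (PhaseSpace τ n) (Fin n → ℂ)) S.Phi (S.reducedMatrix L α h) h
  have key2 := key hj
  exact key2 x

/-- On the curves in `W` the projected system is the reduced linear equation. -/
theorem isSolution_iff {α : Fin p → ℂ} {h : Fin c → S.Q1} (hN : S.N L α h = 0) (T : ℝ)
    (x : ℝ → Fin c → ℂ) :
    S.IsSolution L T (fun t => ((x t, α), (S.rowMul h (x t), 0))) ↔
      ∀ t ∈ Ico (0 : ℝ) T, HasDerivWithinAt x (S.reducedMatrix L α h *ᵥ x t) (Ico 0 T) t := by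
  have e0 : α + extC ((0 : R1 τ p).1.1) 0 = α := add_zero α
  have key : ∀ t, S.B *ᵥ x t + S.Psi0 *ᵥ ((L (α + extC ((0 : R1 τ p).1.1) 0) - S.L₀)
      (S.PhiMul (x t) + S.fn (S.rowMul h (x t)))) = S.reducedMatrix L α h *ᵥ x t := fun t => by
    rw [e0, reducedMatrix_mulVec]
  constructor
  · intro hs t ht
    have := (hs t ht).1
    simp only [key] at this
    exact this
  · intro hx t ht
    refine ⟨?_, hasDerivWithinAt_const _ _ _, ?_, ?_⟩
    · simp only [key]
      exact hx t ht
    · have h1 : HasDerivWithinAt (fun s => ((rowC (fun j => S.fn (h j)) (x s), 0) : JumpSpace τ n))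
          (rowC (fun j => S.fn (h j)) (S.reducedMatrix L α h *ᵥ x t), 0) (Ico 0 T) t :=
        ((ContinuousLinearMap.inl ℂ (PhaseSpace τ n) (Fin n → ℂ) ∘L
          rowC fun j => S.fn (h j)).restrictScalars ℝ).hasFDerivAt.comp_hasDerivWithinAt t (hx t ht)
      have h2 := S.AQ_add_jump_rowMul L hN (x t)
      simp only [e0, h2]
      simp only [fn_rowMul]
      exact h1
    · have h1 : ((((0 : R1 τ p).1.2, -extC ((0 : R1 τ p).1.2) 0)) : JumpSpace τ p) = 0 :=
        Prod.ext rfl neg_zero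
      simp only [h1]
      exact hasDerivWithinAt_const _ _ _

/-- Along a solution with `w = 0` the function `u = Φ x + y` solves the retarded equation
`u̇(t) = L(α) u_t`, written as a transport equation. -/
theorem IsSolution.transport {T : ℝ} {γ : ℝ → S.State p} (hγ : S.IsSolution L T γ) {t : ℝ}
    (ht : t ∈ Ico 0 T) (hw : (γ t).2.2 = 0) :
    HasDerivWithinAt (fun s => S.PhiL (γ s).1.1 + S.fn (γ s).2.1)
        (S.PhiL (S.B *ᵥ (γ t).1.1) + S.dot (γ t).2.1) (Ico 0 T) t ∧
      extC (S.PhiL (S.B *ᵥ (γ t).1.1) + S.dot (γ t).2.1) 0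
        = L (γ t).1.2 (S.PhiL (γ t).1.1 + S.fn (γ t).2.1) := by
  obtain ⟨hx, -, hy, -⟩ := hγ t ht
  have e0 : (γ t).1.2 + extC ((γ t).2.2.1.1) 0 = (γ t).1.2 := by rw [hw]; exact add_zero _
  simp only [e0] at hx hy
  set F := (L (γ t).1.2 - S.L₀) (S.PhiMul (γ t).1.1 + S.fn (γ t).2.1) with hF
  obtain ⟨hy1, hy2⟩ := hasDerivWithinAt_inl ht hy
  rw [jump_eq] at hy1 hy2
  have hx' := (S.PhiL.restrictScalars ℝ).hasFDerivAt.comp_hasDerivWithinAt t hx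
  refine ⟨(hx'.add hy1).congr_deriv ?_, ?_⟩
  · change S.PhiL (S.B *ᵥ (γ t).1.1 + S.Psi0 *ᵥ F) + (S.dot (γ t).2.1 + -S.PhiL (S.Psi0 *ᵥ F)) = _
    rw [map_add]
    abel
  -- The jump part of dy/dt vanishes because y takes values in C_n, so ẏ(0) = L₀y + F. Together with
  -- the boundary condition on P this gives ∂_θu(t,0) = L(α)u.
  · change S.L₀ (S.fn (γ t).2.1) - extC (S.dot (γ t).2.1) 0 + F = 0 at hy2
    have hd : extC (S.dot (γ t).2.1) 0 = S.L₀ (S.fn (γ t).2.1) + F := by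
      rw [← sub_eq_zero, ← neg_eq_zero, ← hy2]
      abel
    have hL : F = L (γ t).1.2 (S.PhiL (γ t).1.1 + S.fn (γ t).2.1)
        - S.L₀ (S.PhiL (γ t).1.1 + S.fn (γ t).2.1) := by
      rw [hF, ← PhiL_apply]; rfl
    rw [extC_add, extC_PhiL_B, hd, hL, map_add S.L₀]
    abel

theorem coef_PhiL_add_fn (x : Fin c → ℂ) (y : S.Q1) : S.coef (S.PhiL x + S.fn y, 0) = x := by
  have e : ((S.PhiL x + S.fn y, 0) : JumpSpace τ n) = (S.PhiL x, 0) + (S.fn y, 0) :=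
    Prod.ext rfl (add_zero _).symm
  rw [e, map_add, coef_PhiL, coef_fn, add_zero]

/-- A solution is determined by its initial value, if this has `w = 0`. -/
theorem IsSolution.eq {T : ℝ} {γ γ' : ℝ → S.State p} (hγ : S.IsSolution L T γ)
    (hγ' : S.IsSolution L T γ') (h0 : γ 0 = γ' 0) (hw : (γ 0).2.2 = 0) {t : ℝ}
    (ht : t ∈ Ico 0 T) : γ t = γ' t := by
  have hT : ∀ {γ : ℝ → S.State p}, S.IsSolution L T γ → (γ 0).2.2 = 0 → ∀ t ∈ Ico 0 T,
      (γ t).1.2 = (γ 0).1.2 ∧ (γ t).2.2 = 0 := by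
    intro γ hγ hw t ht
    refine ⟨eq_of_hasDerivWithinAt_zero (fun s hs => (hγ s hs).2.1) ht, ?_⟩
    -- The jump part of dw/dt must vanish, so ẇ(0) = 0 and uniqueness applies with K = 0.
    have h1 := fun s hs => hasDerivWithinAt_inl hs (hγ s hs).2.2.2
    have h2 : (γ t).2.2.1.1 = 0 := eq_zero_of_transport (v := fun s => (γ s).2.2.1.2) le_rfl
      (fun s hs => (h1 s hs).1) (fun s _ => (γ s).2.2.2.1) (fun s hs => by
        rw [neg_eq_zero.1 (h1 s hs).2, norm_zero, zero_mul]) (by rw [hw]; rfl) ht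
    exact Subtype.ext (C1_ext (γ t).2.2.2.1 (zero_mem _) h2)
  have hw' : (γ' 0).2.2 = 0 := h0 ▸ hw
  have hu := fun s hs => hγ.transport S L hs (hT hγ hw s hs).2
  have hu' := fun s hs => hγ'.transport S L hs (hT hγ' hw' s hs).2
  have hα : ∀ s ∈ Ico 0 T, (γ' s).1.2 = (γ s).1.2 := fun s hs => by
    rw [(hT hγ' hw' s hs).1, (hT hγ hw s hs).1, h0]
  have hα0 : ∀ s ∈ Ico 0 T, (γ s).1.2 = (γ 0).1.2 := fun s hs => (hT hγ hw s hs).1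
  have hmem : ∀ (γ : ℝ → S.State p) s, (S.PhiL (γ s).1.1 + S.fn (γ s).2.1,
      S.PhiL (S.B *ᵥ (γ s).1.1) + S.dot (γ s).2.1) ∈ C1 τ n := fun γ s =>
    add_mem (S.PhiL_mem_C1 (γ s).1.1) (γ s).2.1.2.1
  have hzero := eq_zero_of_transport (T := T) (K := ‖L (γ 0).1.2‖)
    (ContinuousLinearMap.opNorm_nonneg _)
    (u := fun s => (S.PhiL (γ s).1.1 + S.fn (γ s).2.1) - (S.PhiL (γ' s).1.1 + S.fn (γ' s).2.1))
    (v := fun s => (S.PhiL (S.B *ᵥ (γ s).1.1) + S.dot (γ s).2.1)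
      - (S.PhiL (S.B *ᵥ (γ' s).1.1) + S.dot (γ' s).2.1))
    (fun s hs => (hu s hs).1.sub (hu' s hs).1) (fun s _ => sub_mem (hmem γ s) (hmem γ' s))
    (fun s hs => by
      rw [← evalC_apply, map_sub, evalC_apply, evalC_apply, (hu s hs).2, (hu' s hs).2, hα s hs,
        hα0 s hs, ← map_sub]
      exact (L (γ 0).1.2).le_opNorm _) (by simp only [h0]; exact sub_self _) ht
  have hueq : S.PhiL (γ t).1.1 + S.fn (γ t).2.1 = S.PhiL (γ' t).1.1 + S.fn (γ' t).2.1 :=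
    sub_eq_zero.1 hzero
  -- Pairing with Ψ recovers x from u = Φx + y, and then y is determined as well.
  have hx : (γ t).1.1 = (γ' t).1.1 := by
    rw [← S.coef_PhiL_add_fn (γ t).1.1 (γ t).2.1, hueq, coef_PhiL_add_fn]
  have hy : (γ t).2.1 = (γ' t).2.1 := by
    rw [hx] at hueq
    exact S.Q1_ext (add_left_cancel hueq)
  exact Prod.ext (Prod.ext hx (hα t ht).symm)
    (Prod.ext hy ((hT hγ hw t ht).2.trans (hT hγ' hw' t ht).2.symm))

/-- The set `W` of a solution `h` of `N(α,h(α)) = 0` is invariant under the semiflow. -/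
theorem semiflowInvariant_W {V : Set (Fin p → ℂ)} {h : (Fin p → ℂ) → Fin c → S.Q1}
    (hN : ∀ α ∈ V, S.N L α (h α) = 0) : S.SemiflowInvariant L (S.W V h) := by
  intro s hs
  obtain ⟨hα, hy, hw⟩ := hs
  set A : (Fin c → ℂ) →L[ℂ] (Fin c → ℂ) :=
    LinearMap.toContinuousLinearMap (S.reducedMatrix L s.1.2 (h s.1.2)).mulVecLin
  set x : ℝ → Fin c → ℂ := fun t => expFlow A t s.1.1 with hx
  set γ₀ : ℝ → S.State p := fun t => ((x t, s.1.2), (S.rowMul (h s.1.2) (x t), 0)) with hγ₀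
  have hsol : ∀ T, S.IsSolution L T γ₀ := fun T =>
    (S.isSolution_iff L (hN _ hα) T x).2 fun t _ => (hasDerivAt_expFlow A s.1.1 t).hasDerivWithinAt
  have hx0 : x 0 = s.1.1 := expFlow_zero A s.1.1
  have h0 : γ₀ 0 = s := by
    rw [hγ₀]
    simp only [hx0]
    exact Prod.ext rfl (Prod.ext hy.symm hw.symm)
  refine ⟨⟨1, one_pos, γ₀, h0, hsol 1⟩, fun T _ γ hγ0 hγ t ht => ?_⟩
  -- By uniqueness the arbitrary solution equals the exponential one built inside W.
  rw [hγ.eq S L (hsol T) (hγ0.trans h0.symm) (by rw [hγ0]; exact hw) ht]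
  exact ⟨hα, rfl, rfl⟩

end Splitting

theorem mainTheorem6 (τ : ℝ) [Fact (0 < τ)] (n c p : ℕ) (S : Splitting τ n c)
    (L : (Fin p → ℂ) → PhaseSpace τ n →L[ℂ] (Fin n → ℂ))
    (hL : ContDiff ℝ ∞ L) (hL0 : L 0 = S.L₀) :
    -- `N` takes values in `(ker π)^c`
    (∀ (α : Fin p → ℂ) (h : Fin c → S.Q1) (j : Fin c), S.proj (S.N L α h j) = 0) ∧
    -- existence and uniqueness of `h(α)`
    (∃ V : Set (Fin p → ℂ), IsOpen V ∧ IsConnected V ∧ 0 ∈ V ∧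
      ∃ h : (Fin p → ℂ) → Fin c → S.Q1,
        ContDiffOn ℝ ∞ h V ∧ (ContDiff ℂ ∞ L → ContDiffOn ℂ ∞ h V) ∧
        h 0 = 0 ∧ (∀ α ∈ V, S.N L α (h α) = 0) ∧
        ∀ U ⊆ V, IsOpen U → IsConnected U → 0 ∈ U →
          ∀ k : (Fin p → ℂ) → Fin c → S.Q1, ContDiffOn ℝ ∞ k U → k 0 = 0 →
            (∀ α ∈ U, S.N L α (k α) = 0) → EqOn k h U) ∧
    -- every solution `h` gives an invariant manifold with the reduced linear dynamics
    (∀ V : Set (Fin p → ℂ), IsOpen V → 0 ∈ V →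
      ∀ h : (Fin p → ℂ) → Fin c → S.Q1, ContDiffOn ℝ ∞ h V → h 0 = 0 →
        (∀ α ∈ V, S.N L α (h α) = 0) →
        IsSmoothSubmanifold ℝ (2 * (c + p)) (S.W V h) ∧
        (ContDiffOn ℂ ∞ h V → IsSmoothSubmanifold ℂ (c + p) (S.W V h)) ∧
        S.SemiflowInvariant L (S.W V h) ∧
        ∀ α ∈ V, ∀ T > 0, ∀ x : ℝ → Fin c → ℂ,
          S.IsSolution L T (fun t => ((x t, α), (S.rowMul (h α) (x t), 0))) ↔
            ∀ t ∈ Ico (0 : ℝ) T,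
              HasDerivWithinAt x (S.reducedMatrix L α (h α) *ᵥ x t) (Ico 0 T) t) := by
  exact ⟨S.proj_N L, S.exists_unique_solution_N L hL hL0, fun V hV _ h hh _ hN =>
    ⟨S.isSmoothSubmanifold_W_real hV hh, S.isSmoothSubmanifold_W_complex hV,
      S.semiflowInvariant_W L hN, fun α hα T _ x => S.isSolution_iff L (hN α hα) T x⟩⟩
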